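/- Let $\Bbbk$ be an algebraically closed field of characteristic zero, let $m \in \Bbbk\setminus\mathbb{Z}$, and let $f = z(z+m)\in\Bbbk[z]$. Let $A$ be the generalized Weyl algebra $$A = \Bbbk[z]\langle x,y\rangle\big/\big(xz=(z+1)x,\; yz=(z-1)y,\; xy=f(z),\; yx=f(z-1)\big),$$ $\mathbb{Z}$-graded by $\deg x=1$, $\deg y=-1$, $\deg z=0$. Graded modules are $\mathbb{Z}$-graded right $A$-modules, $\operatorname{Hom}_{\mathrm{gr} A}$ denotes homomorphisms of degree $0$, and $M\langle n\rangle_i=M_{i-n}$. For $\mu\in\{0,m\}$ put $X_\mu=A/(x,z+\mu)A$ and $Y_\mu=(A/(y,z+\mu-1)A)\langle 1\rangle$. For $n\in\mathbb{Z}$ let $\iota_{(n,\emptyset)}$ (resp. $\iota_{(\emptyset,n)}$) be the involution that exchanges $X_0\langle n\rangle$ and $Y_0\langle n\rangle$ (resp. $X_m\langle n\rangle$ and $Y_m\langle n\rangle$); on projective modules it is the subfunctor of the identity that sends $P$ to the intersection of the kernels of all graded homomorphisms from $P$ to these two simple modules, and morphisms to their restrictions. Let $\mathbb{Z}_{\mathrm{fin}}$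 be the group of finite subsets of $\mathbb{Z}$ with operation exclusive or $\oplus$, and $\Gamma=\mathbb{Z}_{\mathrm{fin}}\times\mathbb{Z}_{\mathrm{fin}}$. For $\gamma=(J,J')\in\Gamma$ put $$\iota_\gamma=\prod_{j\in J}\iota_{(j,\emptyset)}\prod_{j'\in J'}\iota_{(\emptyset,j')},\qquad h_\gamma=\prod_{j\in J}(z+j)\prod_{j'\in J'}(z+j'+m),$$ and write $\gamma\cap\delta$ for the componentwise intersection. Then for all $\gamma,\delta\in\Gamma$, left multiplication by $h_{\gamma\cap\delta}^{-1}$ is a well-defined isomorphism of graded modules $\Theta_{\gamma,\delta}:\iota_\gamma\iota_\delta A\to\iota_{\gamma+\delta}A$. Let $$D=\bigoplus_{\gamma\in\Gamma}D_\gamma,\qquad D_\gamma=\operatorname{Hom}_{\mathrm{gr} A}(A,\iota_\gamma A),$$ with the product $a\cdot b=\Theta_{\delta,\gamma}\circ\iota_\delta(a)\circ b\in D_{\gamma+\delta}$ for $a\in D_\gamma$, $b\in D_\delta$. Then $D$ has the presentation $$D\;\cong\;\frac{\Bbbk[c_n,d_n\mid n\in\mathbb{Z}]}{\big(c_n^2-n=c_l^2-l,\;\;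 c_n^2=d_n^2-m\;\mid\; l,n\in\mathbb{Z}\big)}$$ as a $\Gamma$-graded $\Bbbk$-algebra, where $\deg c_n=(\{n\},\emptyset)$ and $\deg d_n=(\emptyset,\{n\})$. Under this isomorphism $1$ corresponds to the identity of $A$, $c_n$ to the element of $D_{(\{n\},\emptyset)}$ given by left multiplication by $z+n$, and $d_n$ to the element of $D_{(\emptyset,\{n\})}$ given by left multiplication by $z+n+m$. -/

import Mathlib

open Polynomial DirectSum CategoryTheory
open scoped MulOpposite

universe u

noncomputable section

namespace NCS

/-! ### Internal direct sums -/

theorem isInternal_of_proj {k M : Type*} [Field k] [AddCommGroup M] [Module k M]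
    (V : ℤ → Submodule k M) (p : ℤ → M →ₗ[k] M)
    (h1 : ∀ i, ∀ v ∈ V i, p i v = v) (h2 : ∀ i j, j ≠ i → ∀ v ∈ V i, p j v = 0)
    (htop : ∀ v, v ∈ ⨆ i, V i) : DirectSum.IsInternal V := by
  have key : ∀ (x : ⨁ i, V i) (i : ℤ), p i (DirectSum.coeLinearMap V x) = (x i : M) := by
    intro x i
    induction x using DirectSum.induction_on with
    | zero => simp
    | of j v =>
      rw [DirectSum.coeLinearMap_of]
      by_cases hij : i = j
      · subst hij; rw [h1 i v v.2, DirectSum.of_eq_same]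
      · rw [h2 j i hij v v.2, DirectSum.of_eq_of_ne _ _ _ hij]; rfl
    | add x y hx hy => simp [hx, hy]
  have e : ⇑(DirectSum.coeAddMonoidHom V) = ⇑(DirectSum.coeLinearMap V) := rfl
  refine ⟨?_, ?_⟩
  · rw [e]
    intro x y hxy
    ext i
    rw [← key x i, ← key y i, hxy]
  · rw [e, ← LinearMap.range_eq_top, DirectSum.range_coeLinearMap]
    exact eq_top_iff.2 fun v _ => htop v

/-! ### Generalized Weyl algebras over `k[z]` with `σ(z) = z + 1` -/

/-- Generators of `A(f)`. -/
inductive Gen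
  | x
  | y
  | z

/-- The degree of the generators: `deg x = 1`, `deg y = -1`, `deg z = 0`. -/
def Gen.deg : Gen → ℤ
  | .x => 1
  | .y => -1
  | .z => 0

section GWA

variable (k : Type u) [Field k] (f : k[X])

/-- The defining relations `xz = σ(z)x`, `yz = σ⁻¹(z)y`, `xy = f(z)`, `yx = σ⁻¹(f)(z)`. -/
inductive GWARel : FreeAlgebra k Gen → FreeAlgebra k Gen → Prop
  | xz : GWARel (FreeAlgebra.ι k Gen.x * FreeAlgebra.ι k Gen.z)
      ((FreeAlgebra.ι k Gen.z + 1) * FreeAlgebra.ι k Gen.x)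
  | yz : GWARel (FreeAlgebra.ι k Gen.y * FreeAlgebra.ι k Gen.z)
      ((FreeAlgebra.ι k Gen.z - 1) * FreeAlgebra.ι k Gen.y)
  | xy : GWARel (FreeAlgebra.ι k Gen.x * FreeAlgebra.ι k Gen.y)
      (aeval (FreeAlgebra.ι k Gen.z) f)
  | yx : GWARel (FreeAlgebra.ι k Gen.y * FreeAlgebra.ι k Gen.x)
      (aeval (FreeAlgebra.ι k Gen.z) (f.comp (X - 1)))

/-- The generalized Weyl algebra `A(f) = k[z](σ, f)`. -/
def GWA : Type u := RingQuot (GWARel k f)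

instance : Ring (GWA k f) := inferInstanceAs (Ring (RingQuot (GWARel k f)))

instance : Algebra k (GWA k f) := inferInstanceAs (Algebra k (RingQuot (GWARel k f)))

/-- The quotient map from the free algebra. -/
def GWA.mk : FreeAlgebra k Gen →ₐ[k] GWA k f := RingQuot.mkAlgHom k (GWARel k f)

namespace GWA

/-- The generators `x, y, z` as elements of `A(f)`. -/
def gen (g : Gen) : GWA k f := GWA.mk k f (FreeAlgebra.ι k g)

/-- The degree `i` part of `A(f)`: the span of all words in `x, y, z` of total degree `i`. -/
def comp (i : ℤ) : Submodule k (GWA k f) :=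
  Submodule.span k {a | ∃ w : List Gen, (w.map Gen.deg).sum = i ∧ a = (w.map (gen k f)).prod}

variable {k f}

theorem mk_rel {a b : FreeAlgebra k Gen} (hab : GWARel k f a b) : mk k f a = mk k f b :=
  RingQuot.mkAlgHom_rel k hab

theorem gen_xz : gen k f .x * gen k f .z = (gen k f .z + 1) * gen k f .x := by
  simpa [gen] using mk_rel (GWARel.xz (k := k) (f := f))

theorem gen_yz : gen k f .y * gen k f .z = (gen k f .z - 1) * gen k f .y := by
  simpa [gen] using mk_rel (GWARel.yz (k := k) (f := f))

theorem gen_xy : gen k f .x * gen k f .y = aeval (gen k f .z) f := by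
  have := mk_rel (GWARel.xy (k := k) (f := f))
  rw [map_mul, ← Polynomial.aeval_algHom_apply] at this
  exact this

theorem gen_yx : gen k f .y * gen k f .x = aeval (gen k f .z) (f.comp (X - 1)) := by
  have := mk_rel (GWARel.yx (k := k) (f := f))
  rw [map_mul, ← Polynomial.aeval_algHom_apply] at this
  exact this

theorem one_mem_comp : (1 : GWA k f) ∈ comp k f 0 :=
  Submodule.subset_span ⟨[], by simp, by simp⟩

theorem gen_mem_comp (g : Gen) : gen k f g ∈ comp k f g.deg :=
  Submodule.subset_span ⟨[g], by simp, by simp⟩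

theorem mul_mem_comp {i j : ℤ} {a b : GWA k f} (ha : a ∈ comp k f i) (hb : b ∈ comp k f j) :
    a * b ∈ comp k f (i + j) := by
  have h : comp k f i * comp k f j ≤ comp k f (i + j) := by
    rw [comp, comp, Submodule.span_mul_span]
    refine Submodule.span_le.2 ?_
    rintro _ ⟨_, ⟨w, hw, rfl⟩, _, ⟨w', hw', rfl⟩, rfl⟩
    exact Submodule.subset_span ⟨w ++ w', by simp [hw, hw'], by simp⟩
  exact h (Submodule.mul_mem_mul ha hb)

instance : SetLike.GradedMonoid (comp k f) where
  one_mem := one_mem_comp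
  mul_mem _ _ _ _ ha hb := mul_mem_comp ha hb

theorem mem_iSup_comp (a : GWA k f) : a ∈ ⨆ i, comp k f i := by
  obtain ⟨b, rfl⟩ : ∃ b, mk k f b = a := RingQuot.mkAlgHom_surjective k (GWARel k f) a
  induction b using FreeAlgebra.induction with
  | grade0 r =>
    rw [AlgHom.commutes, Algebra.algebraMap_eq_smul_one]
    exact Submodule.smul_mem _ _ (Submodule.mem_iSup_of_mem 0 one_mem_comp)
  | grade1 g => exact Submodule.mem_iSup_of_mem _ (gen_mem_comp g)
  | mul a b ha hb =>
    rw [map_mul]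
    generalize mk k f a = a' at ha
    generalize mk k f b = b' at hb
    induction ha using Submodule.iSup_induction' with
    | mem i x hx =>
      induction hb using Submodule.iSup_induction' with
      | mem j y hy => exact Submodule.mem_iSup_of_mem _ (mul_mem_comp hx hy)
      | zero => simp
      | add y y' _ _ h h' => rw [mul_add]; exact Submodule.add_mem _ h h'
    | zero => simp
    | add y y' _ _ h h' => rw [add_mul]; exact Submodule.add_mem _ h h'
  | add a b ha hb => rw [map_add]; exact Submodule.add_mem _ ha hb

theorem coaction_aux ⦃a b : FreeAlgebra k Gen⦄ (h : GWARel k f a b) :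
    FreeAlgebra.lift k (fun g => AddMonoidAlgebra.single g.deg (gen k f g)) a =
      FreeAlgebra.lift k (fun g => AddMonoidAlgebra.single g.deg (gen k f g)) b := by
  have hz : ∀ q : k[X], aeval (AddMonoidAlgebra.single (0 : ℤ) (gen k f .z)) q =
      AddMonoidAlgebra.single (0 : ℤ) (aeval (gen k f .z) q) := fun q => by
    have := Polynomial.aeval_algHom_apply
      (AddMonoidAlgebra.singleZeroAlgHom (R := k) (A := GWA k f) (M := ℤ)) (gen k f .z) q
    simpa using this
  cases h with
  | xz => simp [-LaurentPolynomial.single_eq_C_mul_T, Gen.deg, add_mul, AddMonoidAlgebra.single_mul_single, gen_xz,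
      AddMonoidAlgebra.single_add]
  | yz => simp [-LaurentPolynomial.single_eq_C_mul_T, Gen.deg, sub_mul, AddMonoidAlgebra.single_mul_single, gen_yz,
      AddMonoidAlgebra.single_sub]
  | xy =>
    rw [map_mul, ← Polynomial.aeval_algHom_apply]
    simp [-LaurentPolynomial.single_eq_C_mul_T, Gen.deg, AddMonoidAlgebra.single_mul_single, gen_xy, hz]
  | yx =>
    rw [map_mul, ← Polynomial.aeval_algHom_apply]
    simp [-LaurentPolynomial.single_eq_C_mul_T, Gen.deg, AddMonoidAlgebra.single_mul_single, gen_yx, hz]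

/-- The coaction `A(f) → A(f)[T, T⁻¹]`, `a ↦ a Tⁱ` for `a` of degree `i`. -/
def coaction : GWA k f →ₐ[k] AddMonoidAlgebra (GWA k f) ℤ :=
  RingQuot.liftAlgHom k ⟨FreeAlgebra.lift k fun g =>
    AddMonoidAlgebra.single g.deg (gen k f g), coaction_aux⟩

theorem coaction_gen (g : Gen) :
    coaction (gen k f g) = AddMonoidAlgebra.single g.deg (gen k f g) := by
  have := RingQuot.liftAlgHom_mkAlgHom_apply (S := k)
    (f := FreeAlgebra.lift k fun g => AddMonoidAlgebra.single g.deg (gen k f g))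
    (coaction_aux (k := k) (f := f)) (FreeAlgebra.ι k g)
  rw [FreeAlgebra.lift_ι_apply] at this
  exact this

theorem coaction_of_mem {i : ℤ} {a : GWA k f} (ha : a ∈ comp k f i) :
    coaction a = AddMonoidAlgebra.single i a := by
  induction ha using Submodule.span_induction with
  | mem a h =>
    obtain ⟨w, rfl, rfl⟩ := h
    induction w with
    | nil => simp only [List.map_nil, List.prod_nil, List.sum_nil, map_one, AddMonoidAlgebra.one_def]
    | cons g w ih => simp [-LaurentPolynomial.single_eq_C_mul_T, ih, coaction_gen, AddMonoidAlgebra.single_mul_single]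
  | zero => simp
  | add a b _ _ ha hb => simp [-LaurentPolynomial.single_eq_C_mul_T, ha, hb, AddMonoidAlgebra.single_add]
  | smul r a _ ha => simp [-LaurentPolynomial.single_eq_C_mul_T, ha, AddMonoidAlgebra.smul_single]

theorem isInternal_comp : DirectSum.IsInternal (comp k f) := by
  refine isInternal_of_proj _
    (fun i => { toFun := fun a => (coaction a).coeff i, map_add' := ?_, map_smul' := ?_ }) ?_ ?_ 
    mem_iSup_comp
  · intro a b; simp
  · intro a b; simp
  · intro i v hv; simp [-LaurentPolynomial.single_eq_C_mul_T, coaction_of_mem hv]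
  · intro i j hij v hv; simp [-LaurentPolynomial.single_eq_C_mul_T, coaction_of_mem hv, hij.symm]

end GWA
end GWA

/-! ### Graded right modules -/

section GrMod

variable (k : Type u) [Field k] (f : k[X])

/-- `ℤ`-graded right `A(f)`-modules; a right module is a module over the opposite ring. -/
structure GrMod where
  carrier : Type u
  [addCommGroup : AddCommGroup carrier]
  [moduleBase : Module k carrier]
  [module : Module (GWA k f)ᵐᵒᵖ carrier]
  [isScalarTower : IsScalarTower k (GWA k f)ᵐᵒᵖ carrier]
  comp : ℤ → Submodule k carrier
  isInternal : DirectSum.IsInternal comp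
  smul_mem : ∀ (i j : ℤ) (a : GWA k f) (v : carrier), v ∈ comp i → a ∈ GWA.comp k f j →
    MulOpposite.op a • v ∈ comp (i + j)

attribute [instance] GrMod.addCommGroup GrMod.moduleBase GrMod.module GrMod.isScalarTower

variable {k f}

namespace GrMod

instance (M : GrMod k f) : SMulCommClass (GWA k f)ᵐᵒᵖ k M.carrier :=
  IsScalarTower.to_smulCommClass'

/-- The projection of a graded module onto its degree `i` part. -/
def proj (M : GrMod k f) (i : ℤ) : M.carrier →ₗ[k] M.carrier :=
  (M.comp i).subtype ∘ₗ DirectSum.component k ℤ (fun i => M.comp i) i ∘ₗ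
    (LinearEquiv.ofBijective (DirectSum.coeLinearMap M.comp) M.isInternal).symm.toLinearMap

theorem proj_mem (M : GrMod k f) (i : ℤ) (v : M.carrier) : M.proj i v ∈ M.comp i :=
  (DirectSum.component k ℤ (fun i => M.comp i) i
    ((LinearEquiv.ofBijective (DirectSum.coeLinearMap M.comp) M.isInternal).symm v)).2

theorem proj_aux (M : GrMod k f) (i j : ℤ) (v : M.carrier) (hv : v ∈ M.comp i) :
    M.proj j v = ↑(DirectSum.of (fun i => M.comp i) i ⟨v, hv⟩ j : M.comp j) := by
  have : (LinearEquiv.ofBijective (DirectSum.coeLinearMap M.comp) M.isInternal).symm v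
      = DirectSum.of (fun i => M.comp i) i ⟨v, hv⟩ := by
    rw [LinearEquiv.symm_apply_eq]
    exact (DirectSum.coeLinearMap_of M.comp i ⟨v, hv⟩).symm
  change ((DirectSum.component k ℤ (fun i => M.comp i) j
    ((LinearEquiv.ofBijective (DirectSum.coeLinearMap M.comp) M.isInternal).symm v)) :
      M.carrier) = _
  rw [this]
  rfl

theorem proj_of_mem (M : GrMod k f) {i : ℤ} {v : M.carrier} (hv : v ∈ M.comp i) :
    M.proj i v = v := by
  rw [proj_aux M i i v hv, DirectSum.of_eq_same]

theorem proj_of_mem_ne (M : GrMod k f) {i j : ℤ} (hij : j ≠ i) {v : M.carrier}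
    (hv : v ∈ M.comp i) : M.proj j v = 0 := by
  rw [proj_aux M i j v hv, DirectSum.of_eq_of_ne _ _ _ hij]; rfl

theorem mem_iSup_comp (M : GrMod k f) (v : M.carrier) : v ∈ ⨆ i, M.comp i := by
  rw [M.isInternal.submodule_iSup_eq_top]; trivial

theorem exists_sum_proj (M : GrMod k f) (v : M.carrier) :
    ∃ t : Finset ℤ, ∀ t', t ⊆ t' → ∑ i ∈ t', M.proj i v = v := by
  induction M.mem_iSup_comp v using Submodule.iSup_induction' with
  | mem i v hv =>
    refine ⟨{i}, fun t' ht' => ?_⟩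
    rw [Finset.sum_eq_single i (fun j _ hj => proj_of_mem_ne M hj hv)
      (fun h => absurd (ht' (Finset.mem_singleton_self i)) h), proj_of_mem M hv]
  | zero => exact ⟨∅, fun t' _ => by simp⟩
  | add v w _ _ hv hw =>
    obtain ⟨t, ht⟩ := hv
    obtain ⟨u, hu⟩ := hw
    refine ⟨t ∪ u, fun t' ht' => ?_⟩
    simp only [map_add, Finset.sum_add_distrib]
    rw [ht t' (Finset.union_subset_left ht'), hu t' (Finset.union_subset_right ht')]

theorem proj_smul (M : GrMod k f) (i j : ℤ) {a : GWA k f} (ha : a ∈ GWA.comp k f j)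
    (v : M.carrier) :
    M.proj i (MulOpposite.op a • v) = MulOpposite.op a • M.proj (i - j) v := by
  induction M.mem_iSup_comp v using Submodule.iSup_induction' with
  | mem l v hv =>
    by_cases h : i - j = l
    · subst h
      have := M.smul_mem _ _ a v hv ha
      rw [sub_add_cancel] at this
      rw [proj_of_mem M hv, proj_of_mem M this]
    · rw [proj_of_mem_ne M h hv, proj_of_mem_ne M (by lia) (M.smul_mem _ _ a v hv ha), smul_zero]
  | zero => simp
  | add v w _ _ hv hw => simp [hv, hw]

/-- Graded homomorphisms (of degree `0`): right `A(f)`-linear maps that preserve degrees. -/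
def gradedHom (M N : GrMod k f) : Submodule k (M.carrier →ₗ[(GWA k f)ᵐᵒᵖ] N.carrier) where
  carrier := {g | ∀ (i : ℤ) (v : M.carrier), v ∈ M.comp i → g v ∈ N.comp i}
  add_mem' hg hg' i v hv := Submodule.add_mem _ (hg i v hv) (hg' i v hv)
  zero_mem' _ _ _ := Submodule.zero_mem _
  smul_mem' r _ hg i v hv := Submodule.smul_mem _ r (hg i v hv)

instance : Category (GrMod k f) where
  Hom M N := gradedHom M N
  id M := ⟨LinearMap.id, fun _ _ hv => hv⟩
  comp g g' := ⟨g'.1 ∘ₗ g.1, fun i v hv => g'.2 i _ (g.2 i v hv)⟩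

instance (M N : GrMod k f) : AddCommGroup (M ⟶ N) :=
  inferInstanceAs (AddCommGroup (gradedHom M N))

instance (M N : GrMod k f) : Module k (M ⟶ N) :=
  inferInstanceAs (Module k (gradedHom M N))

/-- The underlying function of a graded homomorphism. -/
def app {M N : GrMod k f} (g : M ⟶ N) : M.carrier →ₗ[(GWA k f)ᵐᵒᵖ] N.carrier := g.1

theorem hom_ext {M N : GrMod k f} {g g' : M ⟶ N} (h : ∀ v, app g v = app g' v) : g = g' :=
  Subtype.ext (LinearMap.ext h)

theorem app_mem {M N : GrMod k f} (g : M ⟶ N) {i : ℤ} {v : M.carrier} (hv : v ∈ M.comp i) :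
    app g v ∈ N.comp i := g.2 i v hv

theorem app_proj {M N : GrMod k f} (g : M ⟶ N) (i : ℤ) (v : M.carrier) :
    app g (M.proj i v) = N.proj i (app g v) := by
  induction M.mem_iSup_comp v using Submodule.iSup_induction' with
  | mem j v hv =>
    by_cases hij : i = j
    · subst hij; rw [proj_of_mem M hv, proj_of_mem N (app_mem g hv)]
    · rw [proj_of_mem_ne M hij hv, proj_of_mem_ne N hij (app_mem g hv), map_zero]
  | zero => simp
  | add v w _ _ hv hw => simp [hv, hw]

/-- The free module `A(f)_{A(f)}`. -/
def free (k : Type u) [Field k] (f : k[X]) : GrMod k f where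
  carrier := GWA k f
  comp := GWA.comp k f
  isInternal := GWA.isInternal_comp
  smul_mem _ _ _ _ hv ha := GWA.mul_mem_comp hv ha

/-- The shift `M⟨n⟩`, with `M⟨n⟩ᵢ = M_{i - n}`. -/
def shift (M : GrMod k f) (n : ℤ) : GrMod k f where
  carrier := M.carrier
  comp i := M.comp (i - n)
  isInternal := by
    refine isInternal_of_proj _ (fun i => M.proj (i - n)) (fun i v hv => proj_of_mem M hv)
      (fun i j hij v hv => proj_of_mem_ne M (by simpa using hij) hv) (fun v => ?_)
    have h := M.mem_iSup_comp v
    rwa [← (Equiv.subRight n).iSup_comp] at h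
  smul_mem i j a v hv ha := by
    have := M.smul_mem _ _ a v hv ha
    rwa [show i + j - n = i - n + j by ring]

/-- The degree `i` part of a submodule. -/
def subComp (M : GrMod k f) (N : Submodule (GWA k f)ᵐᵒᵖ M.carrier) (i : ℤ) : Submodule k N where
  carrier := {v | v.1 ∈ M.comp i}
  add_mem' hv hw := Submodule.add_mem _ hv hw
  zero_mem' := Submodule.zero_mem _
  smul_mem' r _ hv := Submodule.smul_mem _ r hv

theorem isInternal_subComp (M : GrMod k f) (N : Submodule (GWA k f)ᵐᵒᵖ M.carrier)
    (hN : ∀ i, ∀ v ∈ N, M.proj i v ∈ N) : DirectSum.IsInternal (M.subComp N) := by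
  refine isInternal_of_proj _
    (fun i => { toFun := fun v => ⟨M.proj i v.1, hN i _ v.2⟩
                map_add' := fun v w => Subtype.ext (map_add (M.proj i) v.1 w.1)
                map_smul' := fun r v => Subtype.ext ((M.proj i).map_smul r v.1) })
    (fun i v hv => Subtype.ext (proj_of_mem M hv))
    (fun i j hij v hv => Subtype.ext (proj_of_mem_ne M hij hv)) (fun v => ?_)
  obtain ⟨t, ht⟩ := M.exists_sum_proj v.1
  have key : v = ∑ i ∈ t, (⟨M.proj i v.1, hN i _ v.2⟩ : N) := by
    apply Subtype.ext
    rw [AddSubmonoidClass.coe_finsetSum]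
    exact (ht t subset_rfl).symm
  rw [key]
  exact Submodule.sum_mem _ fun i _ => Submodule.mem_iSup_of_mem i (proj_mem M i v.1)

/-- A homogeneous submodule, with the induced grading. -/
def sub (M : GrMod k f) (N : Submodule (GWA k f)ᵐᵒᵖ M.carrier)
    (hN : ∀ i, ∀ v ∈ N, M.proj i v ∈ N) : GrMod k f where
  carrier := N
  comp := M.subComp N
  isInternal := M.isInternal_subComp N hN
  smul_mem i j a v hv ha := M.smul_mem i j a v.1 hv ha

/-- The quotient by a homogeneous submodule, with the induced grading. -/
def quot (M : GrMod k f) (N : Submodule (GWA k f)ᵐᵒᵖ M.carrier)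
    (hN : ∀ i, ∀ v ∈ N, M.proj i v ∈ N) : GrMod k f where
  carrier := M.carrier ⧸ N
  comp i := (M.comp i).map (N.mkQ.restrictScalars k)
  isInternal := by
    refine isInternal_of_proj _ (fun i =>
      { toFun := QuotientAddGroup.map N.toAddSubgroup N.toAddSubgroup
          (M.proj i).toAddMonoidHom (hN i)
        map_add' := map_add _
        map_smul' := ?_ }) ?_ ?_ ?_
    · intro r v
      induction v using Submodule.Quotient.induction_on with
      | H v => exact congrArg N.mkQ ((M.proj i).map_smul r v)
    · rintro i _ ⟨v, hv, rfl⟩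
      exact congrArg N.mkQ (proj_of_mem M hv)
    · rintro i j hij _ ⟨v, hv, rfl⟩
      exact congrArg N.mkQ (proj_of_mem_ne M hij hv)
    · intro v
      obtain ⟨v, rfl⟩ := N.mkQ_surjective v
      rw [← Submodule.map_iSup]
      exact ⟨v, M.mem_iSup_comp v, rfl⟩
  smul_mem i j a v hv ha := by
    obtain ⟨v, hv, rfl⟩ := hv
    exact ⟨MulOpposite.op a • v, M.smul_mem i j a v hv ha, by simp⟩

theorem proj_mem_span (M : GrMod k f) (S : Set M.carrier) (hS : ∀ s ∈ S, ∃ i, s ∈ M.comp i)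
    (i : ℤ) (v : M.carrier) (hv : v ∈ Submodule.span (GWA k f)ᵐᵒᵖ S) :
    M.proj i v ∈ Submodule.span (GWA k f)ᵐᵒᵖ S := by
  induction hv using Submodule.span_induction generalizing i with
  | mem s hs =>
    obtain ⟨j, hj⟩ := hS s hs
    by_cases hij : i = j
    · subst hij; rw [proj_of_mem M hj]; exact Submodule.subset_span hs
    · rw [proj_of_mem_ne M hij hj]; exact Submodule.zero_mem _
  | zero => rw [map_zero]; exact Submodule.zero_mem _
  | add v w _ _ hv hw => rw [map_add]; exact Submodule.add_mem _ (hv i) (hw i)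
  | smul a v _ hv =>
    induction a using MulOpposite.rec' with
    | _ a =>
      induction GWA.mem_iSup_comp a using Submodule.iSup_induction' with
      | mem j a ha => rw [proj_smul M i j ha]; exact Submodule.smul_mem _ _ (hv _)
      | zero => simp
      | add a b _ _ ha hb =>
        rw [MulOpposite.op_add, add_smul, map_add]; exact Submodule.add_mem _ ha hb

/-- The intersection of the kernels of all graded homomorphisms `M → X` and `M → Y`. -/
def reject (X Y M : GrMod k f) : Submodule (GWA k f)ᵐᵒᵖ M.carrier :=
  (⨅ g : M ⟶ X, LinearMap.ker (app g)) ⊓ (⨅ g : M ⟶ Y, LinearMap.ker (app g))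

theorem mem_reject {X Y M : GrMod k f} {v : M.carrier} :
    v ∈ reject X Y M ↔ (∀ g : M ⟶ X, app g v = 0) ∧ (∀ g : M ⟶ Y, app g v = 0) := by
  simp [reject]

theorem proj_mem_reject (X Y M : GrMod k f) (i : ℤ) (v : M.carrier) (hv : v ∈ reject X Y M) :
    M.proj i v ∈ reject X Y M := by
  rw [mem_reject] at hv ⊢
  exact ⟨fun g => by rw [app_proj, hv.1 g, map_zero], fun g => by rw [app_proj, hv.2 g, map_zero]⟩

/-- The subfunctor `M ↦ reject X Y M` of the identity functor; it acts on morphisms by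
restriction. -/
def rejectFunctor (X Y : GrMod k f) : GrMod k f ⥤ GrMod k f where
  obj M := M.sub (reject X Y M) (proj_mem_reject X Y M)
  map {M N} g := ⟨(app g).restrict (fun v hv => by
      rw [mem_reject] at hv ⊢
      exact ⟨fun g' => hv.1 (g ≫ g'), fun g' => hv.2 (g ≫ g')⟩),
    fun i v hv => g.2 i v.1 hv⟩
  map_id _ := rfl
  map_comp _ _ := rfl

/-- The inclusion of `rejectFunctor X Y` into the identity functor. -/
def rejectIncl (X Y : GrMod k f) : rejectFunctor X Y ⟶ 𝟭 (GrMod k f) where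
  app M := ⟨(reject X Y M).subtype, fun _ _ hv => hv⟩
  naturality _ _ _ := rfl

/-! ### The graded simple modules and the involutions -/

theorem gen_add_mem_comp (c : k) :
    GWA.gen k f .z + algebraMap k (GWA k f) c ∈ GWA.comp k f 0 := by
  refine Submodule.add_mem _ (GWA.gen_mem_comp .z) ?_
  rw [Algebra.algebraMap_eq_smul_one]
  exact Submodule.smul_mem _ _ GWA.one_mem_comp

/-- The graded module `A / (x, z + μ)A`. -/
def simpleX (f : k[X]) (μ : k) : GrMod k f :=
  (free k f).quot (Submodule.span (GWA k f)ᵐᵒᵖ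
      {GWA.gen k f .x, GWA.gen k f .z + algebraMap k (GWA k f) μ})
    (proj_mem_span (free k f) _ (by
      rintro s (rfl | rfl)
      · exact ⟨1, GWA.gen_mem_comp .x⟩
      · exact ⟨0, gen_add_mem_comp μ⟩))

/-- The graded module `(A / (y, z + μ - 1)A)⟨1⟩`. -/
def simpleY (f : k[X]) (μ : k) : GrMod k f :=
  ((free k f).quot (Submodule.span (GWA k f)ᵐᵒᵖ
      {GWA.gen k f .y, GWA.gen k f .z + algebraMap k (GWA k f) (μ - 1)})
    (proj_mem_span (free k f) _ (by
      rintro s (rfl | rfl)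
      · exact ⟨-1, GWA.gen_mem_comp .y⟩
      · exact ⟨0, gen_add_mem_comp (μ - 1)⟩))).shift 1

/-- The involution that exchanges `X_μ⟨n⟩` and `Y_μ⟨n⟩`, as a subfunctor of the identity.
A rank one projective `P` surjects onto exactly one of `X_μ⟨n⟩`, `Y_μ⟨n⟩`, and is sent to the
kernel of this (up to scalars unique) surjection; morphisms are restricted.
An autoequivalence of the category of graded modules is determined by its restriction to
projective modules, and only the values of the functors on the projective modules
`A, ι_γ A, ι_γ ι_δ A` enter the construction of the ring `D` below. -/
def iotaOne (f : k[X]) (s : k × ℤ) : GrMod k f ⥤ GrMod k f :=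
  rejectFunctor ((simpleX f s.1).shift s.2) ((simpleY f s.1).shift s.2)

/-- The composition of the involutions in a list. -/
def iotaList (f : k[X]) : List (k × ℤ) → (GrMod k f ⥤ GrMod k f)
  | [] => 𝟭 _
  | s :: l => iotaList f l ⋙ iotaOne f s

theorem iotaList_map_zero (l : List (k × ℤ)) {M N : GrMod k f} :
    (iotaList f l).map (0 : M ⟶ N) = 0 := by
  induction l with
  | nil => rfl
  | cons s l ih =>
    change (iotaOne f s).map ((iotaList f l).map 0) = 0
    rw [ih]
    rfl

theorem iotaList_map_add (l : List (k × ℤ)) {M N : GrMod k f} (g g' : M ⟶ N) :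
    (iotaList f l).map (g + g') = (iotaList f l).map g + (iotaList f l).map g' := by
  induction l with
  | nil => rfl
  | cons s l ih =>
    change (iotaOne f s).map ((iotaList f l).map (g + g')) = _
    rw [ih]
    rfl

/-- The inclusion of a composition of involutions into the identity functor. -/
def inclList (f : k[X]) : ∀ (l : List (k × ℤ)) (M : GrMod k f), (iotaList f l).obj M ⟶ M
  | [], M => 𝟙 M
  | s :: l, M => (rejectIncl ((simpleX f s.1).shift s.2) ((simpleY f s.1).shift s.2)).app
      ((iotaList f l).obj M) ≫ inclList f l M

end GrMod
end GrMod

/-! ### The group `ℤ_fin` -/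

/-- The group of finite sets of integers with the operation exclusive or. -/
def ZFin : Type := Finset ℤ

namespace ZFin

/-- The underlying finite set. -/
def set (J : ZFin) : Finset ℤ := J

/-- A finite set of integers as an element of `ZFin`. -/
def ofSet (J : Finset ℤ) : ZFin := J

instance : DecidableEq ZFin := inferInstanceAs (DecidableEq (Finset ℤ))

instance : Zero ZFin := ⟨ofSet ∅⟩

instance : Add ZFin := ⟨fun I J => ofSet (symmDiff I.set J.set)⟩

instance : Neg ZFin := ⟨fun I => I⟩

instance : AddCommGroup ZFin where
  add_assoc I J K := symmDiff_assoc I.set J.set K.set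
  zero_add I := bot_symmDiff I.set
  add_zero I := symmDiff_bot I.set
  nsmul := nsmulRec
  zsmul := zsmulRec
  neg_add_cancel I := symmDiff_self I.set
  add_comm I J := symmDiff_comm I.set J.set

end ZFin

/-- The group `Γ = ℤ_fin × ℤ_fin`. -/
abbrev Gam : Type := ZFin × ZFin

/-- The degree `(n, ∅)`. -/
def degC (n : ℤ) : Gam := (ZFin.ofSet {n}, 0)

/-- The degree `(∅, n)`. -/
def degD (n : ℤ) : Gam := (0, ZFin.ofSet {n})

/-! ### The ring `D` -/

section D

variable {k : Type u} [Field k] (m : k)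

/-- The polynomial `f = z(z + m)`. -/
def fm : k[X] := X * (X + C m)

/-- The algebra `A = A(z(z + m))` as a graded right module over itself. -/
abbrev AMod : GrMod k (fm m) := GrMod.free k (fm m)

/-- `(J, J')` as a list of indices of involutions: `(0, j)` for `j ∈ J`, which stands for
`ι_(j, ∅)`, and `(m, j')` for `j' ∈ J'`, which stands for `ι_(∅, j')`. -/
def indexList (γ : Gam) : List (k × ℤ) :=
  ((γ.1.set.sort (· ≤ ·)).map fun j => ((0 : k), j)) ++
    ((γ.2.set.sort (· ≤ ·)).map fun j => (m, j))

/-- `ι_(J, J') = ∏_{j ∈ J} ι_(j, ∅) ∏_{j' ∈ J'} ι_(∅, j')`. -/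
def iota (γ : Gam) : GrMod k (fm m) ⥤ GrMod k (fm m) := GrMod.iotaList (fm m) (indexList m γ)

theorem iota_map_zero (γ : Gam) (M N : GrMod k (fm m)) : (iota m γ).map (0 : M ⟶ N) = 0 :=
  GrMod.iotaList_map_zero _

theorem iota_map_add (γ : Gam) {M N : GrMod k (fm m)} (g g' : M ⟶ N) :
    (iota m γ).map (g + g') = (iota m γ).map g + (iota m γ).map g' :=
  GrMod.iotaList_map_add _ _ _

/-- The inclusion `ι_γ M → M`. -/
def incl (γ : Gam) (M : GrMod k (fm m)) : (iota m γ).obj M ⟶ M :=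
  GrMod.inclList (fm m) (indexList m γ) M

/-- `h_(J, J') = ∏_{j ∈ J} (z + j) ∏_{j' ∈ J'} (z + j' + m)`, as an element of `A`, for a pair
of finite sets of integers. -/
def hElem (J J' : Finset ℤ) : GWA k (fm m) :=
  aeval (GWA.gen k (fm m) .z)
    ((∏ j ∈ J, (X + C (j : k))) * ∏ j ∈ J', (X + C ((j : k) + m)) : k[X])

/-- `Θ : ι_γ ι_δ A → ι_{γ + δ} A` is left multiplication by the inverse of `h_{γ ∩ δ}`, all
modules being regarded as submodules of `A`. (The target is written `ι_{δ + γ} A`.) -/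
def IsTheta (γ δ : Gam)
    (Θ : (iota m γ).obj ((iota m δ).obj (AMod m)) ⟶ (iota m (δ + γ)).obj (AMod m)) : Prop :=
  ∀ v, (hElem m (γ.1.set ∩ δ.1.set) (γ.2.set ∩ δ.2.set) *
      show GWA k (fm m) from GrMod.app (incl m (δ + γ) (AMod m)) (GrMod.app Θ v)) =
    GrMod.app (incl m δ (AMod m)) (GrMod.app (incl m γ ((iota m δ).obj (AMod m))) v)

open Classical in
/-- The homomorphism `Θ_{γ,δ} : ι_γ ι_δ A → ι_{γ + δ} A` that is left multiplication by the
inverse of `h_{γ ∩ δ}`. -/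
def theta (γ δ : Gam) :
    (iota m γ).obj ((iota m δ).obj (AMod m)) ⟶ (iota m (δ + γ)).obj (AMod m) :=
  if H : ∃ Θ, IsTheta m γ δ Θ then H.choose else 0

/-- `D_γ = Hom_{gr A}(A, ι_γ A)`. -/
abbrev DComp (γ : Gam) : Type u := AMod m ⟶ (iota m γ).obj (AMod m)

/-- The product `a · b = Θ_{δ,γ} ∘ ι_δ(a) ∘ b` of `a ∈ D_γ` and `b ∈ D_δ`. -/
def dMul {γ δ : Gam} (a : DComp m γ) (b : DComp m δ) : DComp m (γ + δ) :=
  b ≫ (iota m δ).map a ≫ theta m δ γ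

instance : DirectSum.GNonUnitalNonAssocSemiring (DComp m) where
  mul a b := dMul m a b
  mul_zero a := GrMod.hom_ext fun v => by
    change GrMod.app (theta m _ _) (GrMod.app ((iota m _).map a) 0) = 0
    simp
  zero_mul b := GrMod.hom_ext fun v => by
    change GrMod.app (theta m _ _) (GrMod.app ((iota m _).map 0) (GrMod.app b v)) = 0
    rw [iota_map_zero]
    exact map_zero _
  mul_add a b c := GrMod.hom_ext fun v => by
    change GrMod.app (theta m _ _) (GrMod.app ((iota m _).map a)
        (GrMod.app b v + GrMod.app c v)) = GrMod.app (theta m _ _) _ + GrMod.app (theta m _ _) _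
    rw [map_add, map_add]
    rfl
  add_mul a b c := GrMod.hom_ext fun v => by
    change GrMod.app (theta m _ _) (GrMod.app ((iota m _).map (a + b)) (GrMod.app c v)) =
      GrMod.app (theta m _ _) _ + GrMod.app (theta m _ _) _
    rw [iota_map_add]
    exact map_add _ _ _

/-- `φ ∈ D_γ` is left multiplication by `b`, where `ι_γ A` is regarded as a submodule of `A`. -/
def IsLeftMul {γ : Gam} (φ : DComp m γ) (b : GWA k (fm m)) : Prop :=
  ∀ a : GWA k (fm m), GrMod.app (incl m γ (AMod m)) (GrMod.app φ a) = b * a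

/-- The ring `D = ⨁_γ Hom_{gr A}(A, ι_γ A)`. -/
abbrev D : Type u := ⨁ γ, DComp m γ

end D

/-! ### The presentation -/

section Pres

variable {k : Type u} [Field k] (m : k)

/-- The variables `c_n` of the polynomial ring `k[c_n, d_n | n ∈ ℤ]`. -/
def polyC (k : Type u) [Field k] (n : ℤ) : MvPolynomial (ℤ ⊕ ℤ) k := MvPolynomial.X (Sum.inl n)

/-- The variables `d_n` of the polynomial ring `k[c_n, d_n | n ∈ ℤ]`. -/
def polyD (k : Type u) [Field k] (n : ℤ) : MvPolynomial (ℤ ⊕ ℤ) k := MvPolynomial.X (Sum.inr n)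

/-- The ideal of the relations `c_n² - n = c_l² - l` and `c_n² = d_n² - m`. -/
def presIdeal : Ideal (MvPolynomial (ℤ ⊕ ℤ) k) :=
  Ideal.span
    ({r | ∃ n l : ℤ, r = (polyC k n ^ 2 - (n : MvPolynomial (ℤ ⊕ ℤ) k)) -
        (polyC k l ^ 2 - (l : MvPolynomial (ℤ ⊕ ℤ) k))} ∪
      {r | ∃ n : ℤ, r = polyC k n ^ 2 - (polyD k n ^ 2 - MvPolynomial.C m)})

/-- The ring `k[c_n, d_n | n ∈ ℤ] / (c_n² - n = c_l² - l, c_n² = d_n² - m | l, n ∈ ℤ)`. -/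
abbrev Pres : Type u := MvPolynomial (ℤ ⊕ ℤ) k ⧸ presIdeal m

/-- The class of `c_n`. -/
def presC (n : ℤ) : Pres m := Ideal.Quotient.mk (presIdeal m) (polyC k n)

/-- The class of `d_n`. -/
def presD (n : ℤ) : Pres m := Ideal.Quotient.mk (presIdeal m) (polyD k n)

/-- The part of `Pres` of degree `γ`, where `deg c_n = (n, ∅)` and `deg d_n = (∅, n)`. -/
def presComp (γ : Gam) : Submodule k (Pres m) :=
  (MvPolynomial.weightedHomogeneousSubmodule k (Sum.elim degC degD) γ).map
    (Ideal.Quotient.mkₐ k (presIdeal m)).toLinearMap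

end Pres

end NCS
end

/-! The algebra `A` is free over `k[z]` on elements `bᵢ`, where `bᵢ` is `xⁱ` for `i ≥ 0` and `y⁻ⁱ`
for `i < 0`. Every module reached from `A` by the involutions is, up to its embedding, a right ideal
`⨁ᵢ aᵢ k[z] bᵢ`, so it is recorded by a family of polynomials `aᵢ` (`HasDiv`), and the involutions
are computed on such families.

The module `X_μ⟨n⟩` lives in degrees `≤ n` and `Y_μ⟨n⟩` in degrees `> n`; in degree `i` of either,
`z` acts as the scalar `i - n - μ`. Hence only the factor `z + n + μ` of the `aᵢ` matters for maps
to them. As `m` is not an integer and the characteristic is zero, this factor divides `f(z + i)`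
only for `i = n`, and there exactly once. So its exponent in `aᵢ` can jump only between the degrees
`n` and `n + 1`, and the jump takes one of two values. For one of them the ideal maps onto `X_μ⟨n⟩`
and has no nonzero map to `Y_μ⟨n⟩`; for the other the roles are exchanged. Passing to the kernel
multiplies `aᵢ` by `z + n + μ` exactly for `i ≤ n`, respectively `i > n` (`mem_reject_low`,
`mem_reject_high`), and this switches the value of the jump.

Two applications of one involution therefore multiply the whole ideal by `z + n + μ`. Consequently
`ι_γ ι_δ A = h_{γ∩δ} ι_{γ+δ} A` inside `A`, which gives `Θ` (`exists_theta`). A single application,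
starting from `A`, always multiplies the coefficient in degree `0`; so `D_γ`, which is the degree
`0` part of `ι_γ A`, consists of the left multiplications by elements of `h_γ k[z]`. Dividing by
`h_γ` identifies `D_γ` with `k[z]`, and the product of `D` becomes `(p, q) ↦ h_{γ∩δ} p q`
(`dPoly_mul`).

In the presented ring put `z = c₀²`. The relations then say `c_n² = z + n` and `d_n² = z + n + m`,
so the squarefree monomials satisfy the same rule `c_γ c_δ = h_{γ∩δ} c_{γ+δ}` (`cMon_mul`). Thus `p
↦ p(z) c_γ` defines a multiplicative surjection from `D`. It is injective because the presented ring
maps to a group algebra of `Γ` over a field containing square roots of all `z + n` and `z + n + m`,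
where the `γ`-component recovers `p` (`exists_hom_groupAlgebra`). -/

noncomputable section

namespace NCS

/-! ### Normal form: `A(f)` is free over `k[z]` on the powers of `x` and `y`. -/

section Coord

variable {k : Type u} [Field k] (f : k[X])

/-- The coefficient `ξᵢ` in `bᵢ x = ξᵢ bᵢ₊₁`. -/
def xi (i : ℤ) : k[X] := if 0 ≤ i then 1 else f.comp (X + C (i : k))

/-- The coefficient `ηᵢ` in `bᵢ₊₁ y = ηᵢ bᵢ`. -/
def eta (i : ℤ) : k[X] := if 0 ≤ i then f.comp (X + C (i : k)) else 1

/-- This is `bᵢ x y = bᵢ f(z) = f(z + i) bᵢ`: the factor `f(z + i)` of a round trip is charged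
entirely to one of the two directions. -/
theorem xi_mul_eta (i : ℤ) : xi f i * eta f i = f.comp (X + C (i : k)) := by
  unfold xi eta; split_ifs <;> simp

/-- The action of the generators from the right on families of polynomials. -/
def coordGen : Gen → Module.End k (ℤ → k[X])
  | .x => { toFun := fun F i => F (i - 1) * xi f (i - 1)
            map_add' := fun F G => by ext1 i; simp [add_mul]
            map_smul' := fun r F => by ext1 i; simp }
  | .y => { toFun := fun F i => F (i + 1) * eta f i
            map_add' := fun F G => by ext1 i; simp [add_mul]
            map_smul' := fun r F => by ext1 i; simp }
  | .z => { toFun := fun F i => F i * (X + C (i : k))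
            map_add' := fun F G => by ext1 i; simp [add_mul]
            map_smul' := fun r F => by ext1 i; simp }

theorem unop_aeval_coordGen_z (p : k[X]) (F : ℤ → k[X]) (i : ℤ) :
    (aeval (MulOpposite.op (coordGen f .z)) p : (Module.End k (ℤ → k[X]))ᵐᵒᵖ).unop F i =
      F i * p.comp (X + C (i : k)) := by
  induction p using Polynomial.induction_on' generalizing F with
  | add p q hp hq => simp [hp, hq, mul_add]
  | monomial n a =>
    rw [aeval_monomial, monomial_comp]
    induction n generalizing F with
    | zero =>
      simp [Algebra.algebraMap_eq_smul_one, MulOpposite.unop_smul, smul_eq_C_mul, mul_comm]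
    | succ n ih =>
      rw [pow_succ, ← mul_assoc, MulOpposite.unop_mul, MulOpposite.unop_op, Module.End.mul_apply]
      change MulOpposite.unop (α := Module.End k (ℤ → k[X])) _ F i * (X + C (i : k)) = _
      rw [ih]
      ring

theorem coordGen_rel ⦃a b : FreeAlgebra k Gen⦄ (h : GWARel k f a b) :
    FreeAlgebra.lift k (fun g => MulOpposite.op (coordGen f g)) a =
      FreeAlgebra.lift k (fun g => MulOpposite.op (coordGen f g)) b := by
  apply MulOpposite.unop_injective
  refine LinearMap.ext fun F => funext fun i => ?_
  cases h with
  | xz =>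
    simp only [map_mul, map_add, map_one, FreeAlgebra.lift_ι_apply, MulOpposite.unop_mul,
      MulOpposite.unop_add, MulOpposite.unop_one, MulOpposite.unop_op, Module.End.mul_apply]
    simp [coordGen]
    ring
  | yz =>
    simp only [map_mul, map_sub, map_one, FreeAlgebra.lift_ι_apply, MulOpposite.unop_mul,
      MulOpposite.unop_sub, MulOpposite.unop_one, MulOpposite.unop_op, Module.End.mul_apply]
    simp [coordGen]
    ring
  | xy =>
    rw [map_mul, ← Polynomial.aeval_algHom_apply]
    simp only [FreeAlgebra.lift_ι_apply, unop_aeval_coordGen_z, MulOpposite.unop_mul,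
      MulOpposite.unop_op, Module.End.mul_apply, ← xi_mul_eta]
    simp [coordGen, mul_assoc]
  | yx =>
    rw [map_mul, ← Polynomial.aeval_algHom_apply]
    have h : (f.comp (X - 1)).comp (X + C (i : k)) = f.comp (X + C ((i - 1 : ℤ) : k)) := by
      rw [comp_assoc]; congr 1; simp; ring
    simp only [FreeAlgebra.lift_ι_apply, unop_aeval_coordGen_z, MulOpposite.unop_mul,
      MulOpposite.unop_op, Module.End.mul_apply, h, ← xi_mul_eta]
    simp [coordGen]
    ring

/-- The right action of `A(f)` on families of polynomials. -/
def coordRep : GWA k f →ₐ[k] (Module.End k (ℤ → k[X]))ᵐᵒᵖ :=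
  RingQuot.liftAlgHom k ⟨FreeAlgebra.lift k fun g => MulOpposite.op (coordGen f g),
    coordGen_rel f⟩

theorem coordRep_gen (g : Gen) : coordRep f (GWA.gen k f g) = MulOpposite.op (coordGen f g) := by
  have := RingQuot.liftAlgHom_mkAlgHom_apply (S := k)
    (f := FreeAlgebra.lift k fun g => MulOpposite.op (coordGen f g)) (coordGen_rel f)
    (FreeAlgebra.ι k g)
  rw [FreeAlgebra.lift_ι_apply] at this
  exact this

variable {f}

/-- The coordinates of an element of `A(f)` with respect to the basis `(bᵢ)` over `k[z]`. -/
def cf (i : ℤ) : GWA k f →ₗ[k] k[X] where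
  toFun a := (coordRep f a).unop (Pi.single 0 1) i
  map_add' a b := by simp
  map_smul' r a := by simp

theorem cf_def (a : GWA k f) : (fun i => cf i a) = (coordRep f a).unop (Pi.single 0 1) := rfl

theorem cf_mul_gen (a : GWA k f) (g : Gen) (i : ℤ) :
    cf i (a * GWA.gen k f g) = coordGen f g (fun i => cf i a) i := by
  rw [cf_def]
  change (coordRep f (a * GWA.gen k f g)).unop (Pi.single 0 1) i = _
  rw [map_mul, coordRep_gen]
  rfl

theorem cf_mul_x (a : GWA k f) (i : ℤ) :
    cf (i + 1) (a * GWA.gen k f .x) = cf i a * xi f i := by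
  rw [cf_mul_gen]; simp [coordGen]

theorem cf_mul_y (a : GWA k f) (i : ℤ) : cf i (a * GWA.gen k f .y) = cf (i + 1) a * eta f i := by
  rw [cf_mul_gen]; simp [coordGen]

theorem cf_mul_z (a : GWA k f) (i : ℤ) :
    cf i (a * GWA.gen k f .z) = cf i a * (X + C (i : k)) := by
  rw [cf_mul_gen]; simp [coordGen]

theorem cf_one (i : ℤ) : cf i (1 : GWA k f) = if i = 0 then 1 else 0 := by
  change (coordRep f 1).unop (Pi.single 0 1) i = _
  rw [map_one]
  simp [Pi.single_apply]

variable (f) in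
/-- The polynomial `p` in `z` as an element of `A(f)`. -/
def zp (p : k[X]) : GWA k f := aeval (GWA.gen k f .z) p

theorem zp_mul (p q : k[X]) : zp f (p * q) = zp f p * zp f q := by simp [zp]

theorem zp_one : zp f (1 : k[X]) = 1 := by simp [zp]

theorem zp_X_add_C (c : k) : zp f (X + C c) = GWA.gen k f .z + algebraMap k (GWA k f) c := by
  simp [zp]

/-- The action is from the right, so it commutes with multiplication of the whole family by a
polynomial. This makes the coordinates left `k[z]`-linear. -/
theorem unop_coordRep_mul (a : GWA k f) (p : k[X]) (F : ℤ → k[X]) (i : ℤ) :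
    (coordRep f a).unop (fun i => p * F i) i = p * (coordRep f a).unop F i := by
  obtain ⟨b, rfl⟩ : ∃ b, GWA.mk k f b = a := RingQuot.mkAlgHom_surjective k (GWARel k f) a
  induction b using FreeAlgebra.induction generalizing F i with
  | grade0 r => simp [Algebra.algebraMap_eq_smul_one]
  | grade1 g =>
    change (coordRep f (GWA.gen k f g)).unop _ i = p * (coordRep f (GWA.gen k f g)).unop _ i
    rw [coordRep_gen]
    cases g <;> simp [coordGen, mul_assoc]
  | mul a b ha hb =>
    simp only [map_mul, MulOpposite.unop_mul, Module.End.mul_apply]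
    rw [← hb]
    exact congrArg (fun G => (coordRep f (GWA.mk k f b)).unop G i) (funext fun j => ha F j)
  | add a b ha hb => simp [ha, hb, mul_add]

theorem cf_zp_mul (p : k[X]) (a : GWA k f) (i : ℤ) : cf i (zp f p * a) = p * cf i a := by
  change (coordRep f (zp f p * a)).unop (Pi.single 0 1) i = p * (coordRep f a).unop _ i
  rw [map_mul, MulOpposite.unop_mul, Module.End.mul_apply, ← unop_coordRep_mul]
  refine congrArg (fun G => (coordRep f a).unop G i) (funext fun j => ?_)
  rw [zp, ← Polynomial.aeval_algHom_apply, coordRep_gen, unop_aeval_coordGen_z]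
  by_cases hj : j = 0
  · subst hj; simp
  · simp [hj]

variable (f) in
/-- The basis `bᵢ` of `A(f)` over `k[z]`: `xⁱ` for `i ≥ 0` and `y⁻ⁱ` for `i < 0`. -/
def base (i : ℤ) : GWA k f :=
  if 0 ≤ i then GWA.gen k f .x ^ i.toNat else GWA.gen k f .y ^ (-i).toNat

theorem base_zero : base f 0 = 1 := by simp [base]

theorem base_nat (n : ℕ) : base f n = GWA.gen k f .x ^ n := by simp [base]

theorem base_neg_nat (n : ℕ) : base f (-n) = GWA.gen k f .y ^ n := by
  rcases n.eq_zero_or_pos with rfl | h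
  · simp [base]
  · rw [base, if_neg (by lia)]; simp

theorem zp_comp_mul {a : GWA k f} {c : k}
    (h : a * GWA.gen k f .z = (GWA.gen k f .z + algebraMap k _ c) * a) (p : k[X]) :
    a * zp f p = zp f (p.comp (X + C c)) * a := by
  induction p using Polynomial.induction_on' with
  | add p q hp hq =>
    simp only [zp, map_add, add_comp] at hp hq ⊢
    rw [mul_add, add_mul, hp, hq]
  | monomial n r =>
    rw [← C_mul_X_pow_eq_monomial]
    induction n with
    | zero => simp [zp, Algebra.commutes]
    | succ n ih =>
      rw [pow_succ, ← mul_assoc, zp_mul, ← mul_assoc, ih, mul_assoc]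
      have : zp f (X : k[X]) = GWA.gen k f .z := by simp [zp]
      rw [this, mul_assoc, h, ← mul_assoc (C r), mul_comp _ X, zp_mul, X_comp, zp_X_add_C, mul_assoc]

theorem base_mul_z (i : ℤ) :
    base f i * GWA.gen k f .z = (GWA.gen k f .z + algebraMap k _ (i : k)) * base f i := by
  obtain ⟨n, rfl | rfl⟩ := i.eq_nat_or_neg
  · rw [base_nat]
    induction n with
    | zero => simp
    | succ n ih =>
      rw [pow_succ, mul_assoc, GWA.gen_xz, ← mul_assoc, mul_add, ih]
      simp [add_mul, mul_assoc, add_assoc]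
  · rw [base_neg_nat]
    induction n with
    | zero => simp
    | succ n ih =>
      rw [pow_succ, mul_assoc, GWA.gen_yz, ← mul_assoc, mul_sub, ih]
      simp [add_mul, sub_mul, mul_assoc]
      abel

theorem base_mul_zp (i : ℤ) (p : k[X]) :
    base f i * zp f p = zp f (p.comp (X + C (i : k))) * base f i :=
  zp_comp_mul (base_mul_z i) p

theorem base_mul_x (i : ℤ) : base f i * GWA.gen k f .x = zp f (xi f i) * base f (i + 1) := by
  by_cases h : 0 ≤ i
  · lift i to ℕ using h
    rw [xi, if_pos (by positivity), zp_one, one_mul, base_nat,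
      show (i : ℤ) + 1 = ((i + 1 : ℕ) : ℤ) by simp, base_nat, pow_succ]
  · obtain ⟨n, rfl⟩ : ∃ n : ℕ, i = -((n + 1 : ℕ) : ℤ) := ⟨(-i - 1).toNat, by lia⟩
    rw [xi, if_neg h, base_neg_nat, pow_succ, mul_assoc, GWA.gen_yx,
      show -((n + 1 : ℕ) : ℤ) + 1 = -(n : ℤ) by push_cast; ring, ← base_neg_nat]
    refine (base_mul_zp _ _).trans ?_
    congr 2
    rw [comp_assoc]
    congr 1
    simp
    ring

theorem base_mul_y (i : ℤ) : base f (i + 1) * GWA.gen k f .y = zp f (eta f i) * base f i := by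
  by_cases h : 0 ≤ i
  · lift i to ℕ using h
    rw [eta, if_pos (by positivity), show (i : ℤ) + 1 = ((i + 1 : ℕ) : ℤ) by simp, base_nat,
      pow_succ, mul_assoc, GWA.gen_xy, ← base_nat]
    exact base_mul_zp _ _
  · obtain ⟨n, rfl⟩ : ∃ n : ℕ, i = -((n + 1 : ℕ) : ℤ) := ⟨(-i - 1).toNat, by lia⟩
    rw [eta, if_neg h, base_neg_nat, pow_succ, zp_one, one_mul,
      show -((n + 1 : ℕ) : ℤ) + 1 = -(n : ℤ) by push_cast; ring, base_neg_nat]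

/-- The `bᵢ` span `A(f)` over `k[z]`, with the coordinates as coefficients; together with `cf_base`
this makes them a basis. -/
theorem cf_eq_of_mem {i : ℤ} {a : GWA k f} (ha : a ∈ GWA.comp k f i) :
    (∀ j, j ≠ i → cf j a = 0) ∧ a = zp f (cf i a) * base f i := by
  induction ha using Submodule.span_induction with
  | mem a h =>
    obtain ⟨w, rfl, rfl⟩ := h
    -- Words are extended at their right end, because the coordinates are computed by a right
    -- action.
    induction w using List.reverseRecOn with
    | nil => exact ⟨fun j hj => by simp at hj; simp [cf_one, hj], by simp [cf_one, zp_one, base_zero]⟩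
    | append_singleton w g ih =>
      simp only [List.map_append, List.map_cons, List.map_nil, List.prod_append, List.prod_cons,
        List.prod_nil, mul_one, List.sum_append, List.sum_cons, List.sum_nil, add_zero]
      generalize (w.map (GWA.gen k f)).prod = a at ih
      generalize (w.map Gen.deg).sum = i at ih
      obtain ⟨h1, h2⟩ := ih
      cases g with
      | x =>
        refine ⟨fun j hj => ?_, ?_⟩
        · obtain ⟨j, rfl⟩ : ∃ l, j = l + 1 := ⟨j - 1, by ring⟩
          rw [cf_mul_x, h1 j (fun h => hj (by rw [h]; rfl)), zero_mul]
        · change _ = zp f (cf (i + 1) _) * base f (i + 1)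
          rw [cf_mul_x, zp_mul, mul_assoc, ← base_mul_x, ← mul_assoc, ← h2]
      | y =>
        obtain ⟨i, rfl⟩ : ∃ l, i = l + 1 := ⟨i - 1, by ring⟩
        simp only [Gen.deg, add_neg_cancel_right]
        refine ⟨fun j hj => ?_, ?_⟩
        · rw [cf_mul_y, h1 _ (by simpa using hj), zero_mul]
        · rw [cf_mul_y, zp_mul, mul_assoc, ← base_mul_y, ← mul_assoc, ← h2]
      | z =>
        simp only [Gen.deg, add_zero]
        refine ⟨fun j hj => ?_, ?_⟩
        · rw [cf_mul_z, h1 j hj, zero_mul]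
        · rw [cf_mul_z, zp_mul, mul_assoc, zp_X_add_C, ← base_mul_z, ← mul_assoc, ← h2]
  | zero => simp [zp]
  | add a b _ _ ha hb =>
    refine ⟨fun j hj => by simp [ha.1 j hj, hb.1 j hj], ?_⟩
    rw [map_add]
    conv_lhs => rw [ha.2, hb.2]
    simp [zp, add_mul]
  | smul r a _ ha =>
    refine ⟨fun j hj => by simp [ha.1 j hj], ?_⟩
    rw [map_smul]
    conv_lhs => rw [ha.2]
    simp [zp]

theorem zp_mem_comp (p : k[X]) : zp f p ∈ GWA.comp k f 0 := by
  induction p using Polynomial.induction_on' with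
  | add p q hp hq => simpa [zp] using Submodule.add_mem _ hp hq
  | monomial n r =>
    rw [zp, aeval_monomial, ← Algebra.smul_def]
    exact Submodule.smul_mem _ _ (Submodule.subset_span
      ⟨List.replicate n .z, by simp [Gen.deg], by simp⟩)

theorem cf_base (i j : ℤ) : cf j (base f i) = if j = i then 1 else 0 := by
  obtain ⟨n, rfl | rfl⟩ := i.eq_nat_or_neg
  · rw [base_nat]
    induction n generalizing j with
    | zero => simp [cf_one]
    | succ n ih =>
      obtain ⟨j, rfl⟩ : ∃ l, j = l + 1 := ⟨j - 1, by ring⟩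
      rw [pow_succ, cf_mul_x, ih]
      by_cases h : j = n
      · subst h; simp [xi]
      · simp [h]
  · rw [base_neg_nat]
    induction n generalizing j with
    | zero => simp [cf_one]
    | succ n ih =>
      rw [pow_succ, cf_mul_y, ih]
      by_cases h : j + 1 = -n
      · rw [if_pos h, if_pos (by push_cast; lia), eta, if_neg (by lia), one_mul]
      · rw [if_neg h, if_neg (by push_cast; lia), zero_mul]

theorem cf_zp_mul_base (p : k[X]) (i j : ℤ) :
    cf j (zp f p * base f i) = if j = i then p else 0 := by
  rw [cf_zp_mul, cf_base]; simp

theorem cf_zp (p : k[X]) : cf 0 (zp f p) = p := by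
  have := cf_zp_mul_base (f := f) p 0 0
  simpa [base_zero] using this

variable (f) in
/-- The projection of `A(f)` onto its degree `i` part. -/
def projA (i : ℤ) : GWA k f →ₗ[k] GWA k f := (GrMod.free k f).proj i

theorem projA_mem (i : ℤ) (a : GWA k f) : projA f i a ∈ GWA.comp k f i :=
  GrMod.proj_mem (GrMod.free k f) i a

theorem projA_of_mem {i : ℤ} {a : GWA k f} (ha : a ∈ GWA.comp k f i) : projA f i a = a :=
  GrMod.proj_of_mem (GrMod.free k f) ha

theorem projA_of_mem_ne {i j : ℤ} (h : j ≠ i) {a : GWA k f} (ha : a ∈ GWA.comp k f i) :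
    projA f j a = 0 :=
  GrMod.proj_of_mem_ne (GrMod.free k f) h ha

theorem cf_projA (i j : ℤ) (a : GWA k f) :
    cf j (projA f i a) = if j = i then cf i a else 0 := by
  induction GWA.mem_iSup_comp a using Submodule.iSup_induction' with
  | mem l a ha =>
    by_cases h : i = l
    · subst h
      rw [projA_of_mem ha]
      split_ifs with h'
      · rw [h']
      · exact (cf_eq_of_mem ha).1 j h'
    · rw [projA_of_mem_ne h ha, (cf_eq_of_mem ha).1 i h]
      simp
  | zero => simp
  | add a b _ _ ha hb =>
    rw [map_add, map_add, map_add, ha, hb]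
    split_ifs <;> simp

theorem projA_eq (i : ℤ) (a : GWA k f) : projA f i a = zp f (cf i a) * base f i := by
  rw [(cf_eq_of_mem (projA_mem i a)).2, cf_projA, if_pos rfl]

theorem exists_sum_projA (a : GWA k f) :
    ∃ t : Finset ℤ, ∀ t', t ⊆ t' → ∑ i ∈ t', projA f i a = a :=
  (GrMod.free k f).exists_sum_proj a

theorem cf_ext {a b : GWA k f} (h : ∀ i, cf i a = cf i b) : a = b := by
  obtain ⟨t, ht⟩ := exists_sum_projA a
  obtain ⟨t', ht'⟩ := exists_sum_projA b
  rw [← ht (t ∪ t') Finset.subset_union_left, ← ht' (t ∪ t') Finset.subset_union_right]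
  exact Finset.sum_congr rfl fun i _ => by rw [projA_eq, projA_eq, h]

/-- A subspace that is closed under right multiplication by the generators is a right ideal. -/
theorem mul_induction {S : Submodule k (GWA k f)}
    (h : ∀ g, ∀ a ∈ S, a * GWA.gen k f g ∈ S) (b : GWA k f) : ∀ a ∈ S, a * b ∈ S := by
  obtain ⟨b, rfl⟩ : ∃ c, GWA.mk k f c = b := RingQuot.mkAlgHom_surjective k (GWARel k f) b
  induction b using FreeAlgebra.induction with
  | grade0 r =>
    intro a ha
    rw [AlgHom.commutes, ← Algebra.commutes, ← Algebra.smul_def]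
    exact Submodule.smul_mem _ _ ha
  | grade1 g => exact h g
  | mul b c hb hc => intro a ha; rw [map_mul, ← mul_assoc]; exact hc _ (hb _ ha)
  | add b c hb hc => intro a ha; rw [map_add, mul_add]; exact Submodule.add_mem _ (hb _ ha) (hc _ ha)

end Coord

open MulOpposite (op)

/-! ### Graded modules identified with right ideals `⨁ᵢ aᵢ k[z] bᵢ`. -/

section Rank

variable {k : Type u} [Field k] {f : k[X]} {N : GrMod k f}

/-- A graded homomorphism to `A(f)` as a map of vector spaces. -/
def emb (ι : N ⟶ GrMod.free k f) : N.carrier →ₗ[k] GWA k f := (GrMod.app ι).restrictScalars k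

theorem emb_smul (ι : N ⟶ GrMod.free k f) (a : GWA k f) (v : N.carrier) :
    emb ι (op a • v) = emb ι v * a :=
  (GrMod.app ι).map_smul (op a) v

theorem emb_mem (ι : N ⟶ GrMod.free k f) {i : ℤ} {v : N.carrier} (hv : v ∈ N.comp i) :
    emb ι v ∈ GWA.comp k f i := ι.2 i v hv

theorem emb_proj (ι : N ⟶ GrMod.free k f) (i : ℤ) (v : N.carrier) :
    emb ι (N.proj i v) = projA f i (emb ι v) := GrMod.app_proj ι i v

/-- The coordinates of `ι v`. -/
def co (ι : N ⟶ GrMod.free k f) (i : ℤ) : N.carrier →ₗ[k] k[X] := cf i ∘ₗ emb ι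

theorem co_apply (ι : N ⟶ GrMod.free k f) (i : ℤ) (v : N.carrier) :
    co ι i v = cf i (emb ι v) := rfl

theorem co_proj (ι : N ⟶ GrMod.free k f) (i j : ℤ) (v : N.carrier) :
    co ι j (N.proj i v) = if j = i then co ι i v else 0 := by
  rw [co_apply, emb_proj, cf_projA]; rfl

theorem co_eq_zero (ι : N ⟶ GrMod.free k f) {i j : ℤ} (hij : j ≠ i) {v : N.carrier}
    (hv : v ∈ N.comp i) : co ι j v = 0 :=
  (cf_eq_of_mem (emb_mem ι hv)).1 j hij

theorem co_smul_x (ι : N ⟶ GrMod.free k f) (i : ℤ) (v : N.carrier) :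
    co ι (i + 1) (op (GWA.gen k f .x) • v) = co ι i v * xi f i := by
  rw [co_apply, emb_smul, cf_mul_x]; rfl

theorem co_smul_y (ι : N ⟶ GrMod.free k f) (i : ℤ) (v : N.carrier) :
    co ι i (op (GWA.gen k f .y) • v) = co ι (i + 1) v * eta f i := by
  rw [co_apply, emb_smul, cf_mul_y]; rfl

theorem co_smul_z (ι : N ⟶ GrMod.free k f) (i : ℤ) (v : N.carrier) :
    co ι i (op (GWA.gen k f .z) • v) = co ι i v * (X + C (i : k)) := by
  rw [co_apply, emb_smul, cf_mul_z]; rfl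

theorem op_algebraMap_smul (N : GrMod k f) (c : k) (v : N.carrier) :
    op (algebraMap k (GWA k f) c) • v = c • v := by
  rw [← MulOpposite.algebraMap_apply, algebraMap_smul]

theorem co_smul_z_add (ι : N ⟶ GrMod.free k f) (i : ℤ) (c : k) (v : N.carrier) :
    co ι i (op (GWA.gen k f .z + algebraMap k _ c) • v) = co ι i v * (X + C (i + c)) := by
  rw [MulOpposite.op_add, add_smul, map_add, co_smul_z, op_algebraMap_smul, map_smul, smul_eq_C_mul,
    C_add]
  ring

theorem zp_mul_base_mul_z_add (p : k[X]) (i : ℤ) (c : k) :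
    zp f p * base f i * (GWA.gen k f .z + algebraMap k _ c) =
      zp f (p * (X + C (i + c))) * base f i := by
  rw [mul_assoc, ← zp_X_add_C, base_mul_zp, ← mul_assoc, ← zp_mul, add_comp, X_comp, C_comp,
    add_assoc, ← C_add]

/-- `ι` identifies `N` with the right ideal `⨁ᵢ aᵢ k[z] bᵢ` of `A(f)`. -/
structure HasDiv (ι : N ⟶ GrMod.free k f) (a : ℤ → k[X]) : Prop where
  ne_zero : ∀ i, a i ≠ 0
  injective : Function.Injective (emb ι)
  mem_range : ∀ b, (∃ v, emb ι v = b) ↔ ∀ i, a i ∣ cf i b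

namespace HasDiv

variable {ι : N ⟶ GrMod.free k f} {a : ℤ → k[X]} (H : HasDiv ι a)
include H

theorem dvd_co (i : ℤ) (v : N.carrier) : a i ∣ co ι i v := (H.mem_range _).1 ⟨v, rfl⟩ i

theorem ext {v w : N.carrier} (h : ∀ i, co ι i v = co ι i w) : v = w :=
  H.injective (cf_ext h)

/-- By injectivity `v` equals its degree `i` projection, since both have the same coordinates. So
the grading of `N` is the one induced from `A(f)`. -/
theorem mem_comp {i : ℤ} {v : N.carrier} (h : ∀ j, j ≠ i → co ι j v = 0) : v ∈ N.comp i := by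
  have : v = N.proj i v := H.ext fun j => by
    rw [co_proj]
    split_ifs with hj
    · rw [hj]
    · exact h j hj
  rw [this]
  exact N.proj_mem i v

theorem ext_of_mem {i : ℤ} {v w : N.carrier} (hv : v ∈ N.comp i) (hw : w ∈ N.comp i)
    (h : co ι i v = co ι i w) : v = w :=
  H.ext fun j => by
    by_cases hj : j = i
    · rw [hj, h]
    · rw [co_eq_zero ι hj hv, co_eq_zero ι hj hw]

theorem exists_of_dvd (i : ℤ) {p : k[X]} (hp : a i ∣ p) : ∃ v ∈ N.comp i, co ι i v = p := by
  obtain ⟨v, hv⟩ := (H.mem_range (zp f p * base f i)).2 fun j => by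
    rw [cf_zp_mul_base]
    split_ifs with h
    · rwa [h]
    · exact dvd_zero _
  have h : ∀ j, co ι j v = if j = i then p else 0 := fun j => by
    rw [co_apply, hv, cf_zp_mul_base]
  exact ⟨v, H.mem_comp fun j hj => by rw [h, if_neg hj], by rw [h, if_pos rfl]⟩

/-- Apply `x` to the element of degree `i` with coordinate `aᵢ`. These divisibilities, with those
for `y`, express that the family describes a right ideal. -/
theorem dvd_mul_xi (i : ℤ) : a (i + 1) ∣ a i * xi f i := by
  obtain ⟨v, -, hv⟩ := H.exists_of_dvd i dvd_rfl
  have := H.dvd_co (i + 1) (op (GWA.gen k f .x) • v)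
  rwa [co_smul_x, hv] at this

theorem dvd_mul_eta (i : ℤ) : a i ∣ a (i + 1) * eta f i := by
  obtain ⟨v, -, hv⟩ := H.exists_of_dvd (i + 1) dvd_rfl
  have := H.dvd_co i (op (GWA.gen k f .y) • v)
  rwa [co_smul_y, hv] at this

omit H in
theorem smul_x_mem {i : ℤ} {v : N.carrier} (hv : v ∈ N.comp i) :
    op (GWA.gen k f .x) • v ∈ N.comp (i + 1) := N.smul_mem i 1 _ v hv (GWA.gen_mem_comp .x)

omit H in
theorem smul_y_mem {i : ℤ} {v : N.carrier} (hv : v ∈ N.comp (i + 1)) :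
    op (GWA.gen k f .y) • v ∈ N.comp i := by
  simpa [Gen.deg] using N.smul_mem (i + 1) (-1) _ v hv (GWA.gen_mem_comp .y)

/-- If `aᵢ ξᵢ = aᵢ₊₁ χ` with `χ` prime to `q`, then `Nᵢ₊₁ = Nᵢ x + q Nᵢ₊₁`. -/
theorem step_x {q χ : k[X]} {i : ℤ} (h : a i * xi f i = a (i + 1) * χ) (hχ : IsCoprime q χ)
    (v : N.carrier) :
    ∃ w ∈ N.comp i, q * a (i + 1) ∣ co ι (i + 1) (v - op (GWA.gen k f .x) • w) := by
  obtain ⟨c, hc⟩ := H.dvd_co (i + 1) v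
  obtain ⟨u, s, hus⟩ := hχ
  -- With `u q + s χ = 1` and `v` of coordinate `aᵢ₊₁ c`, take `w` of coordinate `aᵢ c s`. What
  -- remains is `aᵢ₊₁ c (1 - s χ) = q aᵢ₊₁ u c`.
  obtain ⟨w, hw, hw'⟩ := H.exists_of_dvd i (Dvd.intro (c * s) rfl)
  refine ⟨w, hw, u * c, ?_⟩
  rw [map_sub, co_smul_x, hw', hc]
  linear_combination (-c * s) * h - a (i + 1) * c * hus

/-- If `aᵢ₊₁ ηᵢ = aᵢ χ` with `χ` prime to `q`, then `Nᵢ = Nᵢ₊₁ y + q Nᵢ`. -/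
theorem step_y {q χ : k[X]} {i : ℤ} (h : a (i + 1) * eta f i = a i * χ) (hχ : IsCoprime q χ)
    (v : N.carrier) :
    ∃ w ∈ N.comp (i + 1), q * a i ∣ co ι i (v - op (GWA.gen k f .y) • w) := by
  obtain ⟨c, hc⟩ := H.dvd_co i v
  obtain ⟨u, s, hus⟩ := hχ
  obtain ⟨w, hw, hw'⟩ := H.exists_of_dvd (i + 1) (Dvd.intro (c * s) rfl)
  refine ⟨w, hw, u * c, ?_⟩
  rw [map_sub, co_smul_y, hw', hc]
  linear_combination (-c * s) * h - a i * c * hus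

/-- The submodule `⨁ᵢ a'ᵢ k[z] bᵢ` of `N`. -/
def divSub (a' : ℤ → k[X]) (hx : ∀ i, a' (i + 1) ∣ a' i * xi f i)
    (hy : ∀ i, a' i ∣ a' (i + 1) * eta f i) : Submodule (GWA k f)ᵐᵒᵖ N.carrier where
  carrier := {v | ∀ i, a' i ∣ co ι i v}
  add_mem' hv hw i := by rw [map_add]; exact dvd_add (hv i) (hw i)
  zero_mem' i := by simp
  smul_mem' b v hv := by
    -- The divisibility conditions are transported to `A(f)`, where closure under the three
    -- generators suffices.
    let S : Submodule k (GWA k f) :=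
      { carrier := {c | ∀ i, a' i ∣ cf i c}
        add_mem' := fun hv hw i => by rw [map_add]; exact dvd_add (hv i) (hw i)
        zero_mem' := fun i => by simp
        smul_mem' := fun r c hc i => by
          rw [map_smul, smul_eq_C_mul]; exact (hc i).mul_left _ }
    have : emb ι v * b.unop ∈ S := by
      refine mul_induction (S := S) (fun g c hc => ?_) b.unop _ hv
      cases g with
      | x =>
        intro i
        obtain ⟨i, rfl⟩ : ∃ l, i = l + 1 := ⟨i - 1, by ring⟩
        rw [cf_mul_x]
        exact (hx i).trans (mul_dvd_mul_right (hc i) _)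
      | y =>
        intro i
        rw [cf_mul_y]
        exact (hy i).trans (mul_dvd_mul_right (hc _) _)
      | z =>
        intro i
        rw [cf_mul_z]
        exact (hc i).mul_right _
    intro i
    have h := this i
    rwa [← emb_smul] at h

/-- Passing to the subfunctor `rejectFunctor`. -/
theorem reject {X Y : GrMod k f} {a' : ℤ → k[X]} (h0 : ∀ i, a' i ≠ 0) (haa : ∀ i, a i ∣ a' i)
    (h : ∀ v, v ∈ GrMod.reject X Y N ↔ ∀ i, a' i ∣ co ι i v) :
    HasDiv ((GrMod.rejectIncl X Y).app N ≫ ι) a' where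
  ne_zero := h0
  injective := fun v w hvw => Subtype.ext (H.injective hvw)
  mem_range b := by
    constructor
    · rintro ⟨v, rfl⟩
      exact (h v.1).1 v.2
    · intro hb
      obtain ⟨v, rfl⟩ := (H.mem_range b).2 fun i => (haa i).trans (hb i)
      exact ⟨⟨v, (h v).2 hb⟩, rfl⟩

end HasDiv

theorem hasDiv_id : HasDiv (𝟙 (GrMod.free k f)) (fun _ => 1) where
  ne_zero _ := one_ne_zero
  injective _ _ h := h
  mem_range b := ⟨fun _ _ => one_dvd _, fun _ => ⟨b, rfl⟩⟩

/-- The map `A(f) → N`, `a ↦ w a`. -/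
def orbit (w : N.carrier) : (GrMod.free k f).carrier →ₗ[(GWA k f)ᵐᵒᵖ] N.carrier where
  toFun := fun a : GWA k f => op a • w
  map_add' a b := by rw [← add_smul]; rfl
  map_smul' c a := by rw [RingHom.id_apply, smul_smul]; rfl

/-- A cyclic module `A/K` is isomorphic to a cyclic quotient `N/N'`. -/
theorem exists_hom_to_cyclic {K : Submodule (GWA k f)ᵐᵒᵖ (GrMod.free k f).carrier}
    (N' : Submodule (GWA k f)ᵐᵒᵖ N.carrier) (r : ℤ) (w : N.carrier)
    (h1 : ∀ a : GWA k f, op a • w ∈ N' ↔ a ∈ K)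
    (h2 : ∀ i, ∀ v ∈ N.comp i, ∃ a ∈ GWA.comp k f (i - r), v - op a • w ∈ N') :
    ∃ g : N.carrier →ₗ[(GWA k f)ᵐᵒᵖ] ((GrMod.free k f).carrier ⧸ K),
      (∀ i, ∀ v ∈ N.comp i, ∃ a : GWA k f, a ∈ GWA.comp k f (i - r) ∧ g v = K.mkQ a) ∧
        ∀ v, g v = 0 ↔ v ∈ N' := by
  -- The map is constructed in the direction `A/K → N/N'`, where it is determined by the image of
  -- `1`, and is inverted after it is shown to be bijective.
  let G := K.liftQ (N'.mkQ ∘ₗ orbit w) (fun a ha => by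
    rw [LinearMap.mem_ker]
    exact (Submodule.Quotient.mk_eq_zero N').2 ((h1 a).2 ha))
  have hG : ∀ a : GWA k f, G (K.mkQ a) = N'.mkQ (op a • w) := fun a => rfl
  have hinj : Function.Injective G := by
    rw [injective_iff_map_eq_zero]
    intro t ht
    obtain ⟨a, rfl⟩ := K.mkQ_surjective t
    replace ht := (hG a).symm.trans ht
    exact (Submodule.Quotient.mk_eq_zero K).2
      ((h1 a).1 ((Submodule.Quotient.mk_eq_zero N').1 ht))
  have hcomp : ∀ i, ∀ v ∈ N.comp i, ∃ a : GWA k f, a ∈ GWA.comp k f (i - r) ∧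
      G (K.mkQ a) = N'.mkQ v := by
    intro i v hv
    obtain ⟨a, ha, h⟩ := h2 i v hv
    exact ⟨a, ha, (hG a).trans ((Submodule.Quotient.eq N').2 h).symm⟩
  have hsurj : Function.Surjective G := by
    intro t
    obtain ⟨v, rfl⟩ := N'.mkQ_surjective t
    induction N.mem_iSup_comp v using Submodule.iSup_induction' with
    | mem i v hv =>
      obtain ⟨a, -, h⟩ := hcomp i v hv
      exact ⟨_, h⟩
    | zero => exact ⟨0, by simp⟩
    | add v v' _ _ h h' =>
      obtain ⟨t, ht⟩ := h
      obtain ⟨t', ht'⟩ := h'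
      exact ⟨t + t', by rw [map_add, map_add, ht, ht']⟩
  let e := LinearEquiv.ofBijective G ⟨hinj, hsurj⟩
  refine ⟨e.symm.toLinearMap ∘ₗ N'.mkQ, fun i v hv => ?_, fun v => ?_⟩
  · obtain ⟨a, ha, h⟩ := hcomp i v hv
    exact ⟨a, ha, e.symm_apply_eq.2 h.symm⟩
  · change e.symm (N'.mkQ v) = 0 ↔ _
    rw [LinearEquiv.map_eq_zero_iff]
    exact Submodule.Quotient.mk_eq_zero N'

end Rank

/-! ### Cyclic modules `A/(G, z + e)A` as quotients of such ideals. -/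

section Simple

variable {k : Type u} [Field k] {f : k[X]} {N : GrMod k f}

/-- As `b` is homogeneous of degree `r`, only the degree `j` part of `a` contributes to degree `r +
j` of `b a`. -/
theorem cf_mul_projA {r j : ℤ} {b : GWA k f} (hb : b ∈ GWA.comp k f r) (a : GWA k f) :
    cf (r + j) (b * projA f j a) = cf (r + j) (b * a) := by
  induction GWA.mem_iSup_comp a using Submodule.iSup_induction' with
  | mem l a ha =>
    by_cases h : j = l
    · subst h; rw [projA_of_mem ha]
    · rw [projA_of_mem_ne h ha, mul_zero, map_zero,
        (cf_eq_of_mem (GWA.mul_mem_comp hb ha)).1 _ (by simpa using h)]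
  | zero => simp
  | add a b _ _ ha hb => rw [map_add, mul_add, mul_add, map_add, map_add, ha, hb]

/-- The right ideal `(G, z + e)A`. -/
def pairIdeal (G : GWA k f) (e : k) : Submodule (GWA k f)ᵐᵒᵖ (GrMod.free k f).carrier :=
  Submodule.span (GWA k f)ᵐᵒᵖ {G, GWA.gen k f .z + algebraMap k (GWA k f) e}

section Cyclic

variable {K : Submodule (GWA k f)ᵐᵒᵖ (GrMod.free k f).carrier}

/-- The statement `a ∈ K` for a right ideal `K`, with `a` an element of the algebra. -/
def InIdeal (K : Submodule (GWA k f)ᵐᵒᵖ (GrMod.free k f).carrier) (a : GWA k f) : Prop := a ∈ K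

theorem InIdeal.mul {a : GWA k f} (h : InIdeal K a) (b : GWA k f) : InIdeal K (a * b) :=
  K.smul_mem (op b) h

theorem InIdeal.zp_mul_base {e : k} (h : InIdeal K (GWA.gen k f .z + algebraMap k _ e))
    {p : k[X]} (hp : X + C e ∣ p) (j : ℤ) : InIdeal K (zp f p * base f j) := by
  obtain ⟨p, rfl⟩ := hp
  rw [zp_mul, mul_assoc, zp_X_add_C]
  exact h.mul _

/-- Since `p(z) x = x p(z - 1)`, everything of positive degree is a left multiple of something by
`x`, hence lies in `xA`. -/
theorem InIdeal.of_x (h : InIdeal K (GWA.gen k f .x)) (p : k[X]) {j : ℤ} (hj : 0 < j) :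
    InIdeal K (zp f p * base f j) := by
  obtain ⟨n, rfl⟩ : ∃ n : ℕ, j = (n + 1 : ℕ) := ⟨(j - 1).toNat, by lia⟩
  have := base_mul_zp (f := f) ((1 : ℕ) : ℤ) (p.comp (X - C 1))
  rw [comp_assoc] at this
  rw [base_nat, pow_succ', ← mul_assoc]
  simp only [sub_comp, X_comp, C_comp, Nat.cast_one, Int.cast_one,
    add_sub_cancel_right, comp_X] at this
  have hx : GWA.gen k f .x = base f 1 := by simp [base]
  rw [hx] at h ⊢
  rw [← this, mul_assoc]
  exact h.mul _

/-- Here `p(z) y = y p(z + 1)`, so everything of negative degree lies in `yA`. -/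
theorem InIdeal.of_y (h : InIdeal K (GWA.gen k f .y)) (p : k[X]) {j : ℤ} (hj : j < 0) :
    InIdeal K (zp f p * base f j) := by
  obtain ⟨n, rfl⟩ : ∃ n : ℕ, j = -(n + 1 : ℕ) := ⟨(-j - 1).toNat, by lia⟩
  have := base_mul_zp (f := f) (-((1 : ℕ) : ℤ)) (p.comp (X + C 1))
  rw [comp_assoc] at this
  rw [base_neg_nat, pow_succ', ← mul_assoc]
  simp only [add_comp, X_comp, C_comp, Nat.cast_one, Int.cast_one,
    Int.cast_neg, C_neg, neg_add_cancel_right, comp_X] at this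
  have hy : GWA.gen k f .y = base f (-1) := by simp [base]
  rw [hy] at h ⊢
  rw [← this, mul_assoc]
  exact h.mul _

/-- Modulo `(z + e)A` a coefficient `p(z)` on the left may be replaced by its value `p(-e)`. So each
degree of the quotient is at most one-dimensional. -/
theorem exists_sub_smul_base {e : k} (h : InIdeal K (GWA.gen k f .z + algebraMap k _ e))
    {j : ℤ} {a : GWA k f} (ha : a ∈ GWA.comp k f j) : ∃ c : k, InIdeal K (a - c • base f j) := by
  refine ⟨(cf j a).eval (-e), ?_⟩
  have h1 : a - (cf j a).eval (-e) • base f j =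
      zp f (cf j a - C ((cf j a).eval (-e))) * base f j := by
    conv_lhs => rw [(cf_eq_of_mem ha).2, cf_zp_mul_base, if_pos rfl]
    simp [zp, sub_mul, Algebra.smul_def]
  rw [h1]
  refine h.zp_mul_base ?_ j
  have := X_sub_C_dvd_sub_C_eval (a := -e) (p := cf j a)
  rwa [C_neg, sub_neg_eq_add] at this

/-- In degree `j`, the operator `z` acts on `A/(…, z + e)A` from the right as `j - e`. -/
theorem mkQ_smul_z_eq_zero {e c : k} (h : InIdeal K (GWA.gen k f .z + algebraMap k _ e)) {j : ℤ}
    (hc : (j : k) + c = e) {a : GWA k f} (ha : a ∈ GWA.comp k f j) :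
    op (GWA.gen k f .z + algebraMap k _ c) • K.mkQ a = 0 := by
  refine (Submodule.Quotient.mk_eq_zero K (x := (show (GrMod.free k f).carrier from
    a * (GWA.gen k f .z + algebraMap k _ c)))).2 ?_
  change InIdeal K (a * (GWA.gen k f .z + algebraMap k _ c))
  rw [(cf_eq_of_mem ha).2, zp_mul_base_mul_z_add, hc]
  exact h.zp_mul_base (dvd_mul_left _ _) j

end Cyclic

theorem app_eq_zero {T : GrMod k f} (g : N ⟶ T) {v : N.carrier}
    (h : ∀ i, GrMod.app g (N.proj i v) = 0) : GrMod.app g v = 0 := by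
  obtain ⟨t, ht⟩ := N.exists_sum_proj v
  rw [← ht t subset_rfl, map_sum]
  exact Finset.sum_eq_zero fun i _ => h i

/-- If `z + c` kills the degree `i` part of `T` then homomorphisms `N → T` vanish on
`Nᵢ (z + c)`. -/
theorem HasDiv.app_eq_zero_of_dvd {ι : N ⟶ GrMod.free k f} {a : ℤ → k[X]} (H : HasDiv ι a)
    {T : GrMod k f} (g : N ⟶ T) {i : ℤ} {c : k}
    (hT : ∀ t ∈ T.comp i, op (GWA.gen k f .z + algebraMap k _ c) • t = 0) {v : N.carrier}
    (hv : v ∈ N.comp i) (hd : (X + C ((i : k) + c)) * a i ∣ co ι i v) : GrMod.app g v = 0 := by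
  obtain ⟨p, hp⟩ := hd
  obtain ⟨w, hw, hw'⟩ := H.exists_of_dvd i (Dvd.intro p rfl)
  have : v = op (GWA.gen k f .z + algebraMap k _ c) • w := by
    refine H.ext_of_mem hv ?_ ?_
    · have := N.smul_mem i 0 _ w hw (GrMod.gen_add_mem_comp c)
      rwa [add_zero] at this
    · rw [co_smul_z_add, hw', hp]; ring
  rw [this, map_smul]
  exact hT _ (GrMod.app_mem g hw)

/-- The quotient of `N` by `⨁ᵢ a'ᵢ k[z] bᵢ`, where `a'ᵢ` is `q aᵢ` in the degrees supporting a
simple module and `aᵢ` in the others, is isomorphic to this simple module. -/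
theorem HasDiv.exists_hom_to_simple {ι : N ⟶ GrMod.free k f} {a : ℤ → k[X]} (H : HasDiv ι a)
    (N' : Submodule (GWA k f)ᵐᵒᵖ N.carrier) {a' : ℤ → k[X]}
    (hN' : ∀ v, v ∈ N' ↔ ∀ i, a' i ∣ co ι i v) {r : ℤ} {e : k} {G : GWA k f} {S : ℤ → Prop}
    (hGS : ∀ K : Submodule (GWA k f)ᵐᵒᵖ (GrMod.free k f).carrier, InIdeal K G →
      ∀ p j, ¬ S j → InIdeal K (zp f p * base f j))
    {w : N.carrier} (hw : w ∈ N.comp r) (hwa : co ι r w = a r) (hwG : op G • w ∈ N')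
    (hS : ∀ j, S j → a' (r + j) = (X + C (r + e)) * a (r + j)) (h0 : S 0)
    (h2 : ∀ i, ∀ v ∈ N.comp i, ∃ b ∈ GWA.comp k f (i - r), v - op b • w ∈ N') :
    ∃ g : N.carrier →ₗ[(GWA k f)ᵐᵒᵖ] ((GrMod.free k f).carrier ⧸ pairIdeal G e),
      (∀ i, ∀ v ∈ N.comp i, ∃ b : GWA k f, b ∈ GWA.comp k f (i - r) ∧
        g v = Submodule.mkQ _ b) ∧ ∀ v, g v = 0 ↔ v ∈ N' := by
  refine exists_hom_to_cyclic N' r w (fun b => ?_) h2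
  set K := pairIdeal G e
  have hKG : InIdeal K G := Submodule.subset_span (Or.inl rfl)
  have hKz : InIdeal K (GWA.gen k f .z + algebraMap k _ e) := Submodule.subset_span (Or.inr rfl)
  have hKN : K ≤ N'.comap (orbit w) := by
    refine Submodule.span_le.2 ?_
    rintro _ (rfl | rfl)
    · exact hwG
    · change op (GWA.gen k f .z + algebraMap k _ e) • w ∈ N'
      rw [hN']
      intro i
      rw [co_smul_z_add]
      by_cases hi : i = r
      · subst hi
        have := hS 0 h0
        rw [add_zero] at this
        rw [this, hwa, mul_comm]
      · rw [co_eq_zero ι hi hw, zero_mul]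
        exact dvd_zero _
  refine ⟨fun hb => ?_, fun hb => hKN hb⟩
  -- Membership in `N'` is tested coordinate by coordinate, so it passes to the homogeneous parts of
  -- `b`.
  have hcomp : ∀ j, op (projA f j b) • w ∈ N' := by
    intro j
    rw [hN'] at hb ⊢
    intro i
    rw [co_apply, emb_smul]
    by_cases hi : i = r + j
    · subst hi
      rw [cf_mul_projA (emb_mem ι hw), ← emb_smul]
      exact hb _
    · rw [(cf_eq_of_mem (GWA.mul_mem_comp (emb_mem ι hw) (projA_mem j b))).1 i hi]
      exact dvd_zero _
  have key : ∀ j, InIdeal K (projA f j b) := by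
    intro j
    by_cases hj : S j
    · obtain ⟨c, hc⟩ := exists_sub_smul_base hKz (projA_mem (f := f) j b)
      by_cases hc0 : c = 0
      · rwa [hc0, zero_smul, sub_zero] at hc
      -- If `c ≠ 0` then `w bⱼ` lies in `N'`. Modulo `N'` the degree `r + j` of `N` is spanned by `w
      -- bⱼ`, so all of it would lie in `N'`; this is impossible because `a'` there is `a` times a
      -- polynomial of degree one.
      · exfalso
        have hN1 : ∀ b' : GWA k f, InIdeal K b' → op b' • w ∈ N' := fun b' h => hKN h
        have hbase : op (base f j) • w ∈ N' := by
          have h3 : op (c • base f j) • w ∈ N' := by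
            have := N'.sub_mem (hcomp j) (hN1 _ hc)
            rwa [← sub_smul, ← MulOpposite.op_sub, sub_sub_cancel] at this
          have h4 := N'.smul_mem (op (algebraMap k (GWA k f) c⁻¹)) h3
          rw [smul_smul, ← MulOpposite.op_mul, ← Algebra.commutes, ← Algebra.smul_def, smul_smul,
            inv_mul_cancel₀ hc0, one_smul] at h4
          exact h4
        have hall : ∀ v ∈ N.comp (r + j), v ∈ N' := by
          intro v hv
          obtain ⟨b', hb', h5⟩ := h2 _ v hv
          rw [add_sub_cancel_left] at hb'
          obtain ⟨c', hc'⟩ := exists_sub_smul_base hKz hb'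
          have h6 := N'.smul_mem (op (algebraMap k (GWA k f) c')) hbase
          rw [smul_smul, ← MulOpposite.op_mul, ← Algebra.commutes, ← Algebra.smul_def] at h6
          have h7 := N'.add_mem (hN1 _ hc') h6
          rw [← add_smul, ← MulOpposite.op_add, sub_add_cancel] at h7
          have := N'.add_mem h5 h7
          rwa [sub_add_cancel] at this
        obtain ⟨v, hv, hva⟩ := H.exists_of_dvd (r + j) dvd_rfl
        have h8 := (hN' v).1 (hall v hv) (r + j)
        rw [hva, hS j hj] at h8
        have h9 : IsUnit (X + C ((r : k) + e)) :=
          isUnit_of_dvd_one ((mul_dvd_mul_iff_right (H.ne_zero (r + j))).1 (by rwa [one_mul]))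
        have := degree_eq_zero_of_isUnit h9
        rw [degree_X_add_C] at this
        exact one_ne_zero this
    · rw [projA_eq]
      exact hGS K hKG _ j hj
  obtain ⟨t, ht⟩ := exists_sum_projA b
  have : InIdeal K (∑ i ∈ t, projA f i b) := K.sum_mem fun i _ => key i
  rwa [ht t subset_rfl] at this

end Simple

/-! ### Homomorphisms to `X_μ⟨n⟩` and `Y_μ⟨n⟩`, and the effect of one involution. -/

section Reject

variable {k : Type u} [Field k] {f : k[X]} {N : GrMod k f}

theorem simpleX_smul_eq_zero {μ c : k} {n i : ℤ} (hc : (i : k) + c = n + μ)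
    {t : ((GrMod.simpleX f μ).shift n).carrier} (ht : t ∈ ((GrMod.simpleX f μ).shift n).comp i) :
    op (GWA.gen k f .z + algebraMap k _ c) • t = 0 := by
  obtain ⟨a, ha, rfl⟩ := ht
  refine mkQ_smul_z_eq_zero (e := μ) (j := i - n) (Submodule.subset_span (Or.inr rfl)) ?_ ha
  push_cast
  linear_combination hc

/-- The class of `1` sits in degree `n`, and everything of positive degree in `A` lies in `xA`. -/
theorem simpleX_eq_zero {μ : k} {n i : ℤ} (hi : n < i)
    {t : ((GrMod.simpleX f μ).shift n).carrier} (ht : t ∈ ((GrMod.simpleX f μ).shift n).comp i) :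
    t = 0 := by
  obtain ⟨a, ha, rfl⟩ := ht
  refine (Submodule.Quotient.mk_eq_zero _).2 ?_
  change InIdeal (pairIdeal (GWA.gen k f .x) μ) a
  rw [(cf_eq_of_mem ha).2]
  exact InIdeal.of_x (Submodule.subset_span (Or.inl rfl)) _ (by lia)

/-- The generator has degree `n + 1` instead of `n`, which is compensated by `μ - 1` instead of `μ`.
Hence the condition on `c` agrees with the one for `X_μ⟨n⟩`. -/
theorem simpleY_smul_eq_zero {μ c : k} {n i : ℤ} (hc : (i : k) + c = n + μ)
    {t : ((GrMod.simpleY f μ).shift n).carrier} (ht : t ∈ ((GrMod.simpleY f μ).shift n).comp i) :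
    op (GWA.gen k f .z + algebraMap k _ c) • t = 0 := by
  obtain ⟨a, ha, rfl⟩ := ht
  refine mkQ_smul_z_eq_zero (e := μ - 1) (j := i - n - 1)
    (Submodule.subset_span (Or.inr rfl)) ?_ ha
  push_cast
  linear_combination hc

/-- The extra shift by `1` puts the class of `1` in degree `n + 1`, and everything of negative
degree in `A` lies in `yA`. -/
theorem simpleY_eq_zero {μ : k} {n i : ℤ} (hi : i ≤ n)
    {t : ((GrMod.simpleY f μ).shift n).carrier} (ht : t ∈ ((GrMod.simpleY f μ).shift n).comp i) :
    t = 0 := by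
  obtain ⟨a, ha, rfl⟩ := ht
  refine (Submodule.Quotient.mk_eq_zero _).2 ?_
  change InIdeal (pairIdeal (GWA.gen k f .y) (μ - 1)) a
  rw [(cf_eq_of_mem ha).2]
  exact InIdeal.of_y (Submodule.subset_span (Or.inl rfl)) _ (by lia)

/-- The linear polynomial `z + n + μ`. -/
def lin (μ : k) (n : ℤ) : k[X] := X + C ((n : k) + μ)

theorem lin_ne_zero (μ : k) (n : ℤ) : lin μ n ≠ 0 := X_add_C_ne_zero _

/-- The behaviour of `a` and `f` at the root of `z + n + μ`: the exponent of `z + n + μ` in `aᵢ` is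
`α` for `i ≤ n` and `β` for `i > n`. -/
structure LocalAt (f : k[X]) (a : ℤ → k[X]) (μ : k) (n : ℤ) (α β : ℕ) : Prop where
  coprime_f : ∀ i, i ≠ n → IsCoprime (lin μ n) (f.comp (X + C (i : k)))
  f_eq : ∃ p, f.comp (X + C (n : k)) = lin μ n * p ∧ IsCoprime (lin μ n) p
  a_eq : ∀ i, ∃ g, a i = lin μ n ^ (if i ≤ n then α else β) * g ∧ IsCoprime (lin μ n) g

namespace LocalAt

variable {a : ℤ → k[X]} {μ : k} {n : ℤ} {α β : ℕ} (L : LocalAt f a μ n α β)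
include L

/-- The simple factor of `f(z + n)` at `z + n + μ` belongs to `ξₙ` when `n < 0` and to `ηₙ` when `n
≥ 0`; no other `ξᵢ` or `ηᵢ` contains it. -/
theorem xi_eq (i : ℤ) : ∃ p, xi f i = lin μ n ^ (if i = n ∧ n < 0 then 1 else 0) * p ∧
    IsCoprime (lin μ n) p := by
  unfold xi
  by_cases hi : i = n
  · subst hi
    by_cases h : i < 0
    · rw [if_neg (by lia), if_pos ⟨rfl, h⟩, pow_one]
      exact L.f_eq
    · rw [if_pos (by lia), if_neg (by lia)]
      exact ⟨1, by simp, isCoprime_one_right⟩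
  · rw [if_neg (fun h : i = n ∧ n < 0 => hi h.1), pow_zero]
    split_ifs
    · exact ⟨1, by simp, isCoprime_one_right⟩
    · exact ⟨_, (one_mul _).symm, L.coprime_f i hi⟩

theorem eta_eq (i : ℤ) : ∃ p, eta f i = lin μ n ^ (if i = n ∧ 0 ≤ n then 1 else 0) * p ∧
    IsCoprime (lin μ n) p := by
  unfold eta
  by_cases hi : i = n
  · subst hi
    by_cases h : 0 ≤ i
    · rw [if_pos (by lia), if_pos ⟨rfl, h⟩, pow_one]
      exact L.f_eq
    · rw [if_neg (by lia), if_neg (by lia)]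
      exact ⟨1, by simp, isCoprime_one_right⟩
  · rw [if_neg (fun h : i = n ∧ 0 ≤ n => hi h.1), pow_zero]
    split_ifs
    · exact ⟨_, (one_mul _).symm, L.coprime_f i hi⟩
    · exact ⟨1, by simp, isCoprime_one_right⟩

-- The equality `s + e = t` says that the powers of `q` cancel exactly, so the cofactor retains no
-- common factor with `q`.
omit L in
theorem exists_coprime_quotient {q b c x : k[X]} (hq : q ≠ 0) {s t e : ℕ}
    (hb : ∃ g, b = q ^ s * g ∧ IsCoprime q g) (hx : ∃ g, x = q ^ e * g ∧ IsCoprime q g)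
    (hc : ∃ g, c = q ^ t * g ∧ IsCoprime q g) (h : s + e = t) (hd : c ∣ b * x) :
    ∃ χ, b * x = c * χ ∧ IsCoprime q χ := by
  obtain ⟨g, rfl, hg⟩ := hb
  obtain ⟨g', rfl, hg'⟩ := hx
  obtain ⟨g'', rfl, -⟩ := hc
  obtain ⟨χ, hχ⟩ := hd
  refine ⟨χ, hχ, ?_⟩
  have h1 : q ^ t * (g * g') = q ^ t * (g'' * χ) := by
    rw [← mul_assoc (q ^ t) g'', ← hχ, ← h]; ring
  have h2 := mul_left_cancel₀ (pow_ne_zero _ hq) h1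
  have h3 := hg.mul_right hg'
  rw [h2] at h3
  exact h3.of_mul_right_right

-- One more power of `q` is available in `b x` than in `c`, and the remaining factor of `c` is prime
-- to `q`.
omit L in
theorem mul_dvd_of_exponent {q b c x : k[X]} {s t e : ℕ}
    (hb : ∃ g, b = q ^ s * g ∧ IsCoprime q g) (hx : ∃ g, x = q ^ e * g ∧ IsCoprime q g)
    (hc : ∃ g, c = q ^ t * g ∧ IsCoprime q g) (h : s + e = t + 1) (hd : c ∣ b * x) :
    q * c ∣ b * x := by
  obtain ⟨g, rfl, -⟩ := hb
  obtain ⟨g', rfl, -⟩ := hx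
  obtain ⟨g'', rfl, hg⟩ := hc
  rw [← mul_assoc, ← pow_succ']
  refine (hg.pow_left).mul_dvd ?_ ((dvd_mul_left _ _).trans hd)
  rw [← h]
  exact ⟨g * g', by ring⟩

/-- The exponents in degrees `i` and `i + 1` differ only for `i = n`. At that place the extra
condition says that the exponent jumps by exactly the amount contributed by `ξₙ`. -/
theorem exists_chi_x {ι : N ⟶ GrMod.free k f} (H : HasDiv ι a) {i : ℤ}
    (hi : i = n → α + (if n < 0 then 1 else 0) = β) :
    ∃ χ, a i * xi f i = a (i + 1) * χ ∧ IsCoprime (lin μ n) χ := by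
  refine exists_coprime_quotient (lin_ne_zero _ _) (L.a_eq i) (L.xi_eq i) (L.a_eq (i + 1)) ?_
    (H.dvd_mul_xi i)
  by_cases h : i = n
  · have := hi h
    subst h
    simpa using this
  · rw [if_neg (fun h' : i = n ∧ n < 0 => h h'.1), add_zero]
    congr 1
    simp only [eq_iff_iff]
    lia

theorem exists_chi_y {ι : N ⟶ GrMod.free k f} (H : HasDiv ι a) {i : ℤ}
    (hi : i = n → β + (if 0 ≤ n then 1 else 0) = α) :
    ∃ χ, a (i + 1) * eta f i = a i * χ ∧ IsCoprime (lin μ n) χ := by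
  refine exists_coprime_quotient (lin_ne_zero _ _) (L.a_eq (i + 1)) (L.eta_eq i) (L.a_eq i) ?_
    (H.dvd_mul_eta i)
  by_cases h : i = n
  · have := hi h
    subst h
    simpa using this
  · rw [if_neg (fun h' : i = n ∧ 0 ≤ n => h h'.1), add_zero]
    congr 1
    simp only [eq_iff_iff]
    lia

end LocalAt

/-- Multiplication of `aᵢ` by `z + n + μ` for `i ≤ n` or for `i > n`. -/
def modify (a : ℤ → k[X]) (μ : k) (n : ℤ) (low : Prop) [Decidable low] (i : ℤ) : k[X] :=
  if (i ≤ n ↔ low) then lin μ n * a i else a i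

theorem dvd_modify (a : ℤ → k[X]) (μ : k) (n : ℤ) (low : Prop) [Decidable low] (i : ℤ) :
    a i ∣ modify a μ n low i := by
  unfold modify
  split_ifs
  · exact dvd_mul_left _ _
  · exact dvd_rfl

theorem modify_eq {a : ℤ → k[X]} {μ : k} {n : ℤ} {low : Prop} [Decidable low] {i : ℤ}
    (h : i ≤ n ↔ low) : modify a μ n low i = lin μ n * a i := if_pos h

theorem modify_eq' {a : ℤ → k[X]} {μ : k} {n : ℤ} {low : Prop} [Decidable low] {i : ℤ}
    (h : ¬ (i ≤ n ↔ low)) : modify a μ n low i = a i := if_neg h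

section

variable {ι : N ⟶ GrMod.free k f} {a : ℤ → k[X]} {μ : k} {n : ℤ} {α β : ℕ}

/-- Only the passage from degree `n` to `n + 1` is in question, when the target is multiplied but
the source is not. There the condition on `α` and `β` leaves a spare factor `z + n + μ`. -/
theorem modify_dvd_xi (H : HasDiv ι a) (L : LocalAt f a μ n α β) {low : Prop} [Decidable low]
    (h : ¬ low → β + (if 0 ≤ n then 1 else 0) = α) (i : ℤ) :
    modify a μ n low (i + 1) ∣ modify a μ n low i * xi f i := by
  by_cases h1 : i + 1 ≤ n ↔ low
  · rw [modify_eq h1]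
    by_cases h2 : i ≤ n ↔ low
    · rw [modify_eq h2, mul_assoc]
      exact mul_dvd_mul_left _ (H.dvd_mul_xi i)
    · rw [modify_eq' h2]
      obtain rfl : i = n := by grind
      have hl : ¬ low := by simpa using h1
      refine LocalAt.mul_dvd_of_exponent (L.a_eq i) (L.xi_eq i) (L.a_eq (i + 1)) ?_
        (H.dvd_mul_xi i)
      have := h hl
      rw [if_pos le_rfl, if_neg (show ¬ i + 1 ≤ i by lia)]
      split_ifs at this ⊢ <;> lia
  · rw [modify_eq' h1]
    exact (H.dvd_mul_xi i).trans (mul_dvd_mul_right (dvd_modify _ _ _ _ _) _)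

theorem modify_dvd_eta (H : HasDiv ι a) (L : LocalAt f a μ n α β) {low : Prop} [Decidable low]
    (h : low → α + (if n < 0 then 1 else 0) = β) (i : ℤ) :
    modify a μ n low i ∣ modify a μ n low (i + 1) * eta f i := by
  by_cases h1 : i ≤ n ↔ low
  · rw [modify_eq h1]
    by_cases h2 : i + 1 ≤ n ↔ low
    · rw [modify_eq h2, mul_assoc]
      exact mul_dvd_mul_left _ (H.dvd_mul_eta i)
    · rw [modify_eq' h2]
      obtain rfl : i = n := by grind
      have hl : low := by simpa using h1
      refine LocalAt.mul_dvd_of_exponent (L.a_eq (i + 1)) (L.eta_eq i) (L.a_eq i) ?_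
        (H.dvd_mul_eta i)
      have := h hl
      rw [if_pos le_rfl, if_neg (show ¬ i + 1 ≤ i by lia)]
      split_ifs at this ⊢ <;> lia
  · rw [modify_eq' h1]
    exact (H.dvd_mul_eta i).trans (mul_dvd_mul_right (dvd_modify _ _ _ _ _) _)

/-- A homomorphism to `T` is zero on `v` if it is so on multiples of `z + n + μ` in the degrees
where `modify` multiplies, and `T` vanishes in the other degrees. -/
theorem HasDiv.app_eq_zero_of_modify (H : HasDiv ι a) {T : GrMod k f} (g : N ⟶ T) {low : Prop}
    [Decidable low]
    (hT : ∀ i, ∀ t ∈ T.comp i, ∀ c : k, (i : k) + c = n + μ →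
      op (GWA.gen k f .z + algebraMap k _ c) • t = 0)
    (hT0 : ∀ i, ¬ (i ≤ n ↔ low) → ∀ t ∈ T.comp i, t = 0) {v : N.carrier}
    (hv : ∀ i, modify a μ n low i ∣ co ι i v) : GrMod.app g v = 0 := by
  refine app_eq_zero g fun i => ?_
  by_cases hi : i ≤ n ↔ low
  · have hc : (i : k) + (n + μ - i) = n + μ := by ring
    refine H.app_eq_zero_of_dvd g (c := n + μ - i) (fun t ht => hT i t ht _ hc)
      (N.proj_mem i v) ?_
    have := hv i
    rw [co_proj, if_pos rfl, hc]
    rwa [modify_eq hi] at this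
  · exact hT0 i hi _ (GrMod.app_mem g (N.proj_mem i v))

theorem dvd_co_of_mem {a' : ℤ → k[X]} {i : ℤ} {v : N.carrier}
    (hv : v ∈ N.comp i) (h : a' i ∣ co ι i v) (j : ℤ) : a' j ∣ co ι j v := by
  by_cases hj : j = i
  · rwa [hj]
  · rw [co_eq_zero ι hj hv]; exact dvd_zero _

theorem exists_orbit_eq (H : HasDiv ι a) {r : ℤ} {w : N.carrier} (hw : w ∈ N.comp r)
    (hwa : co ι r w = a r) {v : N.carrier} (hv : v ∈ N.comp r) :
    ∃ b ∈ GWA.comp k f 0, v = op b • w := by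
  obtain ⟨c, hc⟩ := H.dvd_co r v
  -- Since `bᵣ q(z) = q(z + r) bᵣ`, the coefficient `c(z)` on the left is produced by `c(z - r)` on
  -- the right.
  refine ⟨zp f (c.comp (X - C (r : k))), zp_mem_comp _, H.ext_of_mem hv ?_ ?_⟩
  · simpa using N.smul_mem r 0 _ w hw (zp_mem_comp (f := f) (c.comp (X - C (r : k))))
  · rw [co_apply, co_apply, emb_smul, (cf_eq_of_mem (emb_mem ι hw)).2, mul_assoc, base_mul_zp,
      ← mul_assoc, ← zp_mul, cf_zp_mul_base, if_pos rfl, comp_assoc]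
    rw [← co_apply, ← co_apply, hwa, hc]
    simp

/-- The case where `N` has `X_μ⟨n⟩` as a quotient. -/
theorem mem_reject_low (H : HasDiv ι a) (L : LocalAt f a μ n α β)
    (hαβ : α + (if n < 0 then 1 else 0) = β) (v : N.carrier) :
    v ∈ GrMod.reject ((GrMod.simpleX f μ).shift n) ((GrMod.simpleY f μ).shift n) N ↔
      ∀ i, modify a μ n True i ∣ co ι i v := by
  have hx := modify_dvd_xi (low := True) H L (fun h => absurd trivial h)
  have hy := modify_dvd_eta (low := True) H L (fun _ => hαβ)
  let N' := HasDiv.divSub (ι := ι) _ hx hy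
  obtain ⟨w, hw, hwa⟩ := H.exists_of_dvd n dvd_rfl
  -- Modulo `N'` the module is generated by `w` in degree `n`: degrees above `n` lie in `N'`, and
  -- below `n` each degree is reached by `y` from the next one, up to multiples of `z + n + μ`.
  have h2 : ∀ i, ∀ v ∈ N.comp i, ∃ b ∈ GWA.comp k f (i - n), v - op b • w ∈ N' := by
    intro i
    rcases lt_or_ge n i with hi | hi
    · intro v hv
      refine ⟨0, Submodule.zero_mem _, ?_⟩
      rw [MulOpposite.op_zero, zero_smul, sub_zero]
      refine dvd_co_of_mem hv ?_
      rw [modify_eq' (by simpa using hi)]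
      exact H.dvd_co i v
    · induction i, hi using Int.leInductionDown with
      | base =>
        intro v hv
        obtain ⟨b, hb, rfl⟩ := exists_orbit_eq H hw hwa hv
        exact ⟨b, by simpa using hb, by simp⟩
      | pred i hi ih =>
        intro v hv
        obtain ⟨j, rfl⟩ : ∃ j, i = j + 1 := ⟨i - 1, by ring⟩
        rw [add_sub_cancel_right] at hv ⊢
        obtain ⟨χ, h1, hχ⟩ := L.exists_chi_y H (i := j) (by lia)
        obtain ⟨w', hw', hd⟩ := H.step_y h1 hχ v
        obtain ⟨b, hb, hbw⟩ := ih w' hw'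
        refine ⟨b * GWA.gen k f .y, ?_, ?_⟩
        · have := GWA.mul_mem_comp hb (GWA.gen_mem_comp .y)
          rwa [show j + 1 - n + Gen.y.deg = j - n by simp only [Gen.deg]; ring] at this
        · have h3 : v - op (GWA.gen k f .y) • w' ∈ N' := by
            refine dvd_co_of_mem (Submodule.sub_mem _ hv (HasDiv.smul_y_mem hw')) ?_
            rwa [modify_eq (by simpa using by lia)]
          have h4 := N'.add_mem h3 (N'.smul_mem (op (GWA.gen k f .y)) hbw)
          rwa [smul_sub, smul_smul, sub_add_sub_cancel, ← MulOpposite.op_mul] at h4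
  obtain ⟨g, hg, hg0⟩ := H.exists_hom_to_simple N' (a' := modify a μ n True) (r := n) (e := μ)
    (G := GWA.gen k f .x) (S := fun j => j ≤ 0) (fun v => Iff.rfl)
    (fun K hK p j hj => hK.of_x p (by lia)) hw hwa
    (dvd_co_of_mem (HasDiv.smul_x_mem hw) (by
      rw [modify_eq' (by simp)]; exact H.dvd_co _ _))
    (fun j hj => modify_eq (by simpa using hj)) le_rfl h2
  rw [GrMod.mem_reject]
  constructor
  · intro h
    exact (hg0 v).1 (h.1 ⟨g, fun i v hv => by
      obtain ⟨b, hb, h⟩ := hg i v hv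
      exact ⟨b, hb, h.symm⟩⟩)
  · intro h
    refine ⟨fun g => H.app_eq_zero_of_modify g (fun i t ht c hc => simpleX_smul_eq_zero hc ht)
      (fun i hi t ht => simpleX_eq_zero (by simpa using hi) ht) h, fun g => ?_⟩
    -- There is no nonzero map to `Y_μ⟨n⟩`: it vanishes in degrees `≤ n`, and `Nᵢ₊₁` is `Nᵢ x` up to
    -- multiples of `z + n + μ`, which are killed. The hypothesis `hαβ` is what carries this across
    -- `i = n`.
    have key : ∀ i, ∀ v ∈ N.comp i, GrMod.app g v = 0 := by
      intro i
      rcases lt_or_ge i n with hi | hi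
      · intro v hv
        exact simpleY_eq_zero hi.le (GrMod.app_mem g hv)
      · induction i, hi using Int.leInduction with
        | base => exact fun v hv => simpleY_eq_zero le_rfl (GrMod.app_mem g hv)
        | succ i hi ih =>
          intro v hv
          obtain ⟨χ, h1, hχ⟩ := L.exists_chi_x H (i := i) (fun _ => hαβ)
          obtain ⟨w', hw', hd⟩ := H.step_x h1 hχ v
          have h3 : GrMod.app g (v - op (GWA.gen k f .x) • w') = 0 := by
            have hc : ((i + 1 : ℤ) : k) + (n + μ - (i + 1 : ℤ)) = n + μ := by ring
            refine H.app_eq_zero_of_dvd g (c := n + μ - (i + 1 : ℤ))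
              (fun t ht => simpleY_smul_eq_zero hc ht)
              (Submodule.sub_mem _ hv (HasDiv.smul_x_mem hw')) ?_
            rwa [hc]
          rwa [map_sub, map_smul, ih w' hw', smul_zero, sub_zero] at h3
    exact app_eq_zero g fun i => key i _ (N.proj_mem i v)

/-- The case where `N` has `Y_μ⟨n⟩` as a quotient. -/
theorem mem_reject_high (H : HasDiv ι a) (L : LocalAt f a μ n α β)
    (hαβ : β + (if 0 ≤ n then 1 else 0) = α) (v : N.carrier) :
    v ∈ GrMod.reject ((GrMod.simpleX f μ).shift n) ((GrMod.simpleY f μ).shift n) N ↔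
      ∀ i, modify a μ n False i ∣ co ι i v := by
  have hx := modify_dvd_xi (low := False) H L (fun _ => hαβ)
  have hy := modify_dvd_eta (low := False) H L (fun h => h.elim)
  let N' := HasDiv.divSub (ι := ι) _ hx hy
  -- The generator of `Y_μ⟨n⟩` has degree `n + 1`, so the mirrored argument starts there; the linear
  -- factor is unchanged because `(n + 1) + (μ - 1) = n + μ`.
  obtain ⟨w, hw, hwa⟩ := H.exists_of_dvd (n + 1) dvd_rfl
  have h2 : ∀ i, ∀ v ∈ N.comp i, ∃ b ∈ GWA.comp k f (i - (n + 1)), v - op b • w ∈ N' := by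
    intro i
    rcases lt_or_ge i (n + 1) with hi | hi
    · intro v hv
      refine ⟨0, Submodule.zero_mem _, ?_⟩
      rw [MulOpposite.op_zero, zero_smul, sub_zero]
      refine dvd_co_of_mem hv ?_
      rw [modify_eq' (by simpa using by lia)]
      exact H.dvd_co i v
    · induction i, hi using Int.leInduction with
      | base =>
        intro v hv
        obtain ⟨b, hb, rfl⟩ := exists_orbit_eq H hw hwa hv
        exact ⟨b, by simpa using hb, by simp⟩
      | succ i hi ih =>
        intro v hv
        obtain ⟨χ, h1, hχ⟩ := L.exists_chi_x H (i := i) (by lia)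
        obtain ⟨w', hw', hd⟩ := H.step_x h1 hχ v
        obtain ⟨b, hb, hbw⟩ := ih w' hw'
        refine ⟨b * GWA.gen k f .x, ?_, ?_⟩
        · have := GWA.mul_mem_comp hb (GWA.gen_mem_comp .x)
          rwa [show i - (n + 1) + Gen.x.deg = i + 1 - (n + 1) by simp only [Gen.deg]; ring] at this
        · have h3 : v - op (GWA.gen k f .x) • w' ∈ N' := by
            refine dvd_co_of_mem (Submodule.sub_mem _ hv (HasDiv.smul_x_mem hw')) ?_
            rwa [modify_eq (by simpa using by lia)]
          have h4 := N'.add_mem h3 (N'.smul_mem (op (GWA.gen k f .x)) hbw)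
          rwa [smul_sub, smul_smul, sub_add_sub_cancel, ← MulOpposite.op_mul] at h4
  obtain ⟨g, hg, hg0⟩ := H.exists_hom_to_simple N' (a' := modify a μ n False) (r := n + 1)
    (e := μ - 1) (G := GWA.gen k f .y) (S := fun j => 0 ≤ j) (fun v => Iff.rfl)
    (fun K hK p j hj => hK.of_y p (by lia)) hw hwa
    (dvd_co_of_mem (HasDiv.smul_y_mem hw) (by
      rw [modify_eq' (by simp)]; exact H.dvd_co _ _))
    (fun j hj => by
      rw [modify_eq (by simpa using by lia), lin]
      congr 3
      push_cast
      ring) le_rfl h2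
  rw [GrMod.mem_reject]
  constructor
  · intro h
    exact (hg0 v).1 (h.2 ⟨g, fun i v hv => by
      obtain ⟨b, hb, h⟩ := hg i v hv
      rw [← sub_sub] at hb
      exact ⟨b, hb, h.symm⟩⟩)
  · intro h
    refine ⟨fun g => ?_, fun g => H.app_eq_zero_of_modify g
      (fun i t ht c hc => simpleY_smul_eq_zero hc ht)
      (fun i hi t ht => simpleY_eq_zero (by simpa using hi) ht) h⟩
    -- Maps to `X_μ⟨n⟩` vanish in degrees above `n`, and `y` carries this downwards across the
    -- boundary by `hαβ`.
    have key : ∀ i, ∀ v ∈ N.comp i, GrMod.app g v = 0 := by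
      intro i
      rcases lt_or_ge (n + 1) i with hi | hi
      · intro v hv
        exact simpleX_eq_zero (by lia) (GrMod.app_mem g hv)
      · induction i, hi using Int.leInductionDown with
        | base => exact fun v hv => simpleX_eq_zero (by lia) (GrMod.app_mem g hv)
        | pred i hi ih =>
          intro v hv
          obtain ⟨j, rfl⟩ : ∃ j, i = j + 1 := ⟨i - 1, by ring⟩
          rw [add_sub_cancel_right] at hv
          obtain ⟨χ, h1, hχ⟩ := L.exists_chi_y H (i := j) (fun _ => hαβ)
          obtain ⟨w', hw', hd⟩ := H.step_y h1 hχ v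
          have h3 : GrMod.app g (v - op (GWA.gen k f .y) • w') = 0 := by
            have hc : (j : k) + (n + μ - j) = n + μ := by ring
            refine H.app_eq_zero_of_dvd g (c := n + μ - j)
              (fun t ht => simpleX_smul_eq_zero hc ht)
              (Submodule.sub_mem _ hv (HasDiv.smul_y_mem hw')) ?_
            rwa [hc]
          rwa [map_sub, map_smul, ih w' hw', smul_zero, sub_zero] at h3
    exact app_eq_zero g fun i => key i _ (N.proj_mem i v)

/-- The effect of `ι_s` on right ideals of the form `⨁ᵢ aᵢ k[z] bᵢ`. -/
theorem HasDiv.iotaOne (H : HasDiv ι a) (L : LocalAt f a μ n α β) (low : Prop) [Decidable low]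
    (h1 : low → α + (if n < 0 then 1 else 0) = β)
    (h2 : ¬ low → β + (if 0 ≤ n then 1 else 0) = α) :
    HasDiv ((GrMod.rejectIncl ((GrMod.simpleX f μ).shift n) ((GrMod.simpleY f μ).shift n)).app N
      ≫ ι) (modify a μ n low) := by
  refine H.reject (fun i => ?_) (fun i => dvd_modify _ _ _ _ _) (fun v => ?_)
  · unfold modify
    split_ifs
    · exact mul_ne_zero (lin_ne_zero _ _) (H.ne_zero i)
    · exact H.ne_zero i
  · by_cases hl : low
    · simpa [modify, hl] using mem_reject_low H L (h1 hl) v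
    · simpa [modify, hl] using mem_reject_high H L (h2 hl) v

end

end Reject

/-! ### Iterated involutions: bookkeeping of the exponents. -/

section Lists

variable {k : Type u} [Field k]

theorem isCoprime_X_add_C {a b : k} (h : a ≠ b) : IsCoprime (X + C a) (X + C b : k[X]) := by
  have h0 : a - b ≠ 0 := sub_ne_zero.2 h
  refine ⟨C (a - b)⁻¹, -C (a - b)⁻¹, ?_⟩
  have : C (a - b)⁻¹ * (X + C a) + -C (a - b)⁻¹ * (X + C b) = C ((a - b)⁻¹ * (a - b)) := by
    rw [C_mul, C_sub]; ring
  rw [this, inv_mul_cancel₀ h0, C_1]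

theorem isCoprime_lin {μ ν : k} {n l : ℤ} (h : (n : k) + μ ≠ l + ν) :
    IsCoprime (lin μ n) (lin ν l) := isCoprime_X_add_C h

theorem fm_comp (m : k) (i : ℤ) : (fm m).comp (X + C (i : k)) = lin 0 i * lin m i := by
  simp [fm, lin, add_assoc]

/-- The exponent of `z + n + μ` in degree `i` after `c` applications of `ι_(μ, n)`. -/
def expo (c : ℕ) (n i : ℤ) : ℕ := c / 2 + if Odd c ∧ (0 ≤ n ↔ i ≤ n) then 1 else 0

/-- The applications alternate between the degrees `≤ n` and `> n`, beginning with the side that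
contains degree `0`. -/
theorem expo_succ (c : ℕ) (n i : ℤ) :
    expo (c + 1) n i = expo c n i + if (i ≤ n ↔ (0 ≤ n ↔ Even c)) then 1 else 0 := by
  unfold expo
  obtain ⟨d, rfl | rfl⟩ := c.even_or_odd'
  · have h1 : Odd (2 * d + 1) := ⟨d, rfl⟩
    have h2 : ¬ Odd (2 * d) := by simp
    have h3 : Even (2 * d) := by simp
    have h4 : (2 * d + 1) / 2 = d := by lia
    have h5 : 2 * d / 2 = d := by lia
    simp only [h1, h2, h3, h4, h5, true_and, false_and, iff_true, if_false]
    grind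
  · have h1 : Odd (2 * d + 1) := ⟨d, rfl⟩
    have h2 : ¬ Odd (2 * d + 1 + 1) := by simp [parity_simps]
    have h3 : ¬ Even (2 * d + 1) := by simp
    have h4 : (2 * d + 1) / 2 = d := by lia
    have h5 : (2 * d + 1 + 1) / 2 = d + 1 := by lia
    simp only [h1, h2, h3, h4, h5, true_and, false_and, iff_false, if_false]
    grind

/-- The coefficients `aᵢ` after `c s` applications of `ι_s` for all `s ∈ T`. -/
def divFun (T : Finset (k × ℤ)) (c : k × ℤ → ℕ) (i : ℤ) : k[X] :=
  ∏ s ∈ T, lin s.1 s.2 ^ expo (c s) s.2 i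

theorem divFun_zero (T : Finset (k × ℤ)) : divFun T 0 = fun _ => 1 := by
  ext1 i
  simp [divFun, expo]

/-- All members of `T` have first component `0` or `m`. -/
def Admissible (m : k) (T : Finset (k × ℤ)) : Prop := ∀ s ∈ T, s.1 = 0 ∨ s.1 = m

variable [CharZero k] {m : k} (hm : ∀ n : ℤ, m ≠ (n : k)) {T : Finset (k × ℤ)}
include hm

omit [CharZero k] in
theorem int_add_ne (n l : ℤ) : (n : k) + 0 ≠ l + m := fun h => hm (n - l) (by
  push_cast; linear_combination -h)

/-- Distinct indices give distinct linear factors: for equal first components by characteristic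
zero, for the components `0` and `m` because `m` is not an integer. -/
theorem index_ne (hT : Admissible m T) {s t : k × ℤ} (hs : s ∈ T) (ht : t ∈ T) (hst : s ≠ t) :
    (s.2 : k) + s.1 ≠ t.2 + t.1 := by
  obtain ⟨μ, n⟩ := s
  obtain ⟨ν, l⟩ := t
  rcases hT _ hs with h | h <;> rcases hT _ ht with h' | h' <;> simp only at h h' <;> subst h h'
  · intro h
    simp only [add_zero, Int.cast_inj] at h
    exact hst (by rw [h])
  · exact int_add_ne hm n l
  · exact (int_add_ne hm l n).symm
  · intro h
    simp only [add_left_inj, Int.cast_inj] at h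
    exact hst (by rw [h])

theorem localAt_divFun (hT : Admissible m T) {s : k × ℤ} (hs : s ∈ T) (c : k × ℤ → ℕ) :
    LocalAt (fm m) (divFun T c) s.1 s.2 (c s / 2 + if Odd (c s) ∧ 0 ≤ s.2 then 1 else 0)
      (c s / 2 + if Odd (c s) ∧ s.2 < 0 then 1 else 0) where
  coprime_f i hi := by
    have hi' : (s.2 : k) ≠ i := by simpa using hi.symm
    rw [fm_comp]
    rcases hT s hs with h | h <;> rw [h]
    · exact (isCoprime_lin (by simpa using hi')).mul_right (isCoprime_lin (int_add_ne hm _ _))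
    · exact (isCoprime_lin (int_add_ne hm _ _).symm).mul_right (isCoprime_lin (by simpa using hi'))
  f_eq := by
    rw [fm_comp]
    rcases hT s hs with h | h <;> rw [h]
    · exact ⟨_, rfl, isCoprime_lin (int_add_ne hm _ _)⟩
    · exact ⟨_, mul_comm _ _, isCoprime_lin (int_add_ne hm _ _).symm⟩
  a_eq i := by
    classical
    refine ⟨∏ t ∈ T.erase s, lin t.1 t.2 ^ expo (c t) t.2 i, ?_, ?_⟩
    · rw [divFun, ← Finset.mul_prod_erase T _ hs]
      congr 2
      unfold expo
      split_ifs <;> first | rfl | grind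
    · refine IsCoprime.prod_right fun t ht => (isCoprime_lin ?_).pow_right
      exact index_ne hm hT hs (Finset.mem_of_mem_erase ht) (Finset.ne_of_mem_erase ht).symm

omit [CharZero k] hm in
open Classical in
theorem modify_divFun {s : k × ℤ} (hs : s ∈ T) (c : k × ℤ → ℕ) :
    modify (divFun T c) s.1 s.2 (0 ≤ s.2 ↔ Even (c s)) =
      divFun T (Function.update c s (c s + 1)) := by
  ext1 i
  unfold modify divFun
  rw [← Finset.mul_prod_erase T _ hs, ← Finset.mul_prod_erase T _ hs, Function.update_self,
    expo_succ]
  have : ∏ x ∈ T.erase s, lin x.1 x.2 ^ expo (Function.update c s (c s + 1) x) x.2 i =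
      ∏ x ∈ T.erase s, lin x.1 x.2 ^ expo (c x) x.2 i :=
    Finset.prod_congr rfl fun t ht => by rw [Function.update_of_ne (Finset.ne_of_mem_erase ht)]
  rw [this]
  split_ifs
  · rw [pow_succ]; ring
  · rw [add_zero]

-- Distinct involutions affect coprime factors and hence do not interfere, so only the
-- multiplicities in the list matter. The ambient set `T` allows families for different lists to be
-- compared.
open Classical in
theorem hasDiv_iotaList (hT : Admissible m T) {M : GrMod k (fm m)}
    {ι : M ⟶ GrMod.free k (fm m)} {c : k × ℤ → ℕ} (H : HasDiv ι (divFun T c))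
    (l : List (k × ℤ)) (hl : ∀ s ∈ l, s ∈ T) :
    HasDiv (GrMod.inclList (fm m) l M ≫ ι) (divFun T (fun s => c s + l.count s)) := by
  induction l with
  | nil =>
    have : GrMod.inclList (fm m) [] M ≫ ι = ι := Category.id_comp ι
    have h0 : (fun s => c s + ([] : List (k × ℤ)).count s) = c := by simp
    rw [this, h0]
    exact H
  | cons s l ih =>
    have H' := ih fun t ht => hl t (List.mem_cons_of_mem s ht)
    have hs := hl s List.mem_cons_self
    -- Parity of the number of earlier applications decides which of the two modules is a quotient:
    -- before any application it is `X` for `n ≥ 0` and `Y` for `n < 0`.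
    have h1 := H'.iotaOne (localAt_divFun hm hT hs _)
      (0 ≤ s.2 ↔ Even ((fun s => c s + l.count s) s)) (by
        beta_reduce
        generalize c s + l.count s = d
        intro h
        by_cases hn : 0 ≤ s.2 <;> by_cases hd : Even d <;>
          simp_all [← Nat.not_even_iff_odd, not_lt.2]) (by
        beta_reduce
        generalize c s + l.count s = d
        intro h
        by_cases hn : 0 ≤ s.2 <;> by_cases hd : Even d <;>
          simp_all [← Nat.not_even_iff_odd, not_lt.2])
    rw [modify_divFun hs] at h1
    have h2 : (fun t => c t + (s :: l).count t) =
        Function.update (fun s => c s + l.count s) s ((fun s => c s + l.count s) s + 1) := by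
      ext1 t
      by_cases h : t = s
      · subst h; simp [add_assoc]
      · simp [h, Ne.symm h]
    rw [h2]
    exact h1

end Lists

/-! ### Right ideals that differ by a left factor `h`. -/

section Compare

variable {k : Type u} [Field k] {f : k[X]} {M N : GrMod k f}

theorem zp_mul_left_injective {h : k[X]} (h0 : h ≠ 0) :
    Function.Injective fun a : GWA k f => zp f h * a := fun a b hab => cf_ext fun i => by
  have := congrArg (cf i) hab
  simp only [cf_zp_mul] at this
  exact mul_left_cancel₀ h0 this

/-- If `ι₁` identifies `M` with `h J` and `ι₂` identifies `N` with `J`, then left multiplication by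
`h⁻¹` is an isomorphism from `M` to `N`. -/
theorem HasDiv.exists_iso {ι₁ : M ⟶ GrMod.free k f} {ι₂ : N ⟶ GrMod.free k f} {a : ℤ → k[X]}
    {h : k[X]} (h0 : h ≠ 0) (H₁ : HasDiv ι₁ fun i => h * a i) (H₂ : HasDiv ι₂ a) :
    ∃ Θ : M ⟶ N, IsIso Θ ∧ ∀ v, zp f h * emb ι₂ (GrMod.app Θ v) = emb ι₁ v := by
  have hex : ∀ w, ∃ v, emb ι₁ v = zp f h * emb ι₂ w := fun w => (H₁.mem_range _).2 fun i => by
    rw [cf_zp_mul]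
    exact mul_dvd_mul_left _ (H₂.dvd_co i w)
  choose F hF using hex
  -- Multiplication by `h` is defined from `N` to `M`, which needs no division; `Θ` is its inverse.
  let L : N.carrier →ₗ[(GWA k f)ᵐᵒᵖ] M.carrier :=
    { toFun := F
      map_add' := fun v w => H₁.injective (by rw [map_add, hF, hF, hF, map_add, mul_add])
      map_smul' := fun b v => H₁.injective (by
        have e1 := emb_smul ι₁ b.unop (F v)
        have e2 := emb_smul ι₂ b.unop v
        rw [MulOpposite.op_unop] at e1 e2
        rw [RingHom.id_apply, hF, e1, e2, hF, mul_assoc]) }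
  have hco : ∀ w i, co ι₁ i (L w) = h * co ι₂ i w := fun w i => by
    rw [co_apply]
    change cf i (emb ι₁ (F w)) = _
    rw [hF, cf_zp_mul]
    rfl
  have hinj : Function.Injective L := fun v w hvw => H₂.ext fun i => by
    have := hco v i
    rw [hvw, hco w i] at this
    exact (mul_left_cancel₀ h0 this).symm
  have hcomp : ∀ i, ∀ v ∈ M.comp i, ∃ w ∈ N.comp i, L w = v := by
    intro i v hv
    obtain ⟨c, hc⟩ := H₁.dvd_co i v
    obtain ⟨w, hw, hw'⟩ := H₂.exists_of_dvd i (Dvd.intro c rfl)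
    refine ⟨w, hw, H₁.ext fun j => ?_⟩
    rw [hco]
    by_cases hj : j = i
    · subst hj; rw [hw', hc, mul_assoc]
    · rw [co_eq_zero ι₂ hj hw, co_eq_zero ι₁ hj hv, mul_zero]
  have hsurj : Function.Surjective L := by
    intro v
    induction M.mem_iSup_comp v using Submodule.iSup_induction' with
    | mem i v hv =>
      obtain ⟨w, -, h⟩ := hcomp i v hv
      exact ⟨w, h⟩
    | zero => exact ⟨0, map_zero L⟩
    | add v v' _ _ h h' =>
      obtain ⟨t, ht⟩ := h
      obtain ⟨t', ht'⟩ := h'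
      exact ⟨t + t', by rw [map_add, ht, ht']⟩
  let e := LinearEquiv.ofBijective L ⟨hinj, hsurj⟩
  let Θ : M ⟶ N := ⟨e.symm.toLinearMap, fun i v hv => by
    obtain ⟨w, hw, rfl⟩ := hcomp i v hv
    have : e.symm (L w) = w := e.symm_apply_apply w
    exact this.symm ▸ hw⟩
  let Θ' : N ⟶ M := ⟨L, fun i w hw => H₁.mem_comp fun j hj => by
    rw [hco, co_eq_zero ι₂ hj hw, mul_zero]⟩
  refine ⟨Θ, ⟨Θ', GrMod.hom_ext fun v => e.apply_symm_apply v,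
    GrMod.hom_ext fun v => e.symm_apply_apply v⟩, fun v => ?_⟩
  rw [← hF]
  exact congrArg (emb ι₁) (e.apply_symm_apply v)

end Compare

theorem ZFin.set_add (I J : ZFin) : (I + J).set = symmDiff I.set J.set := rfl

theorem ZFin.set_zero : (0 : ZFin).set = ∅ := rfl

theorem ZFin.set_ofSet (J : Finset ℤ) : (ZFin.ofSet J).set = J := rfl

/-- An index in both sets contributes a square, an index in exactly one set a single factor. Applied
both to the polynomials `h_γ` and to the monomials `c_γ`. -/
theorem prod_mul_prod_eq_symmDiff {R : Type*} [CommMonoid R] (c : ℤ → R) (I J : Finset ℤ) :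
    (∏ j ∈ I, c j) * ∏ j ∈ J, c j = (∏ j ∈ I ∩ J, c j ^ 2) * ∏ j ∈ symmDiff I J, c j := by
  have hI : I ⊆ I ∪ J := Finset.subset_union_left
  have hJ : J ⊆ I ∪ J := Finset.subset_union_right
  have hIJ : I ∩ J ⊆ I ∪ J := Finset.inter_subset_left.trans hI
  have hs : symmDiff I J ⊆ I ∪ J := fun j hj => by
    rw [Finset.mem_symmDiff] at hj
    rw [Finset.mem_union]
    tauto
  have key : ∀ S ⊆ I ∪ J, ∀ d : ℤ → R, ∏ j ∈ S, d j = ∏ j ∈ I ∪ J, if j ∈ S then d j else 1 :=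
    fun S hS d => by rw [Finset.prod_ite_mem, Finset.inter_eq_right.2 hS]
  rw [key I hI, key J hJ, key _ hIJ, key _ hs, ← Finset.prod_mul_distrib,
    ← Finset.prod_mul_distrib]
  refine Finset.prod_congr rfl fun j _ => ?_
  by_cases h1 : j ∈ I <;> by_cases h2 : j ∈ J <;> simp [h1, h2, Finset.mem_symmDiff, pow_two]

section

variable {k : Type u} [Field k] (m : k)

/-- The polynomial `h_(J, J')`. -/
def hPoly (J J' : Finset ℤ) : k[X] := (∏ j ∈ J, (X + C (j : k))) * ∏ j ∈ J', (X + C ((j : k) + m))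

theorem hElem_eq (J J' : Finset ℤ) : hElem m J J' = zp (fm m) (hPoly m J J') := rfl

theorem hPoly_ne_zero (J J' : Finset ℤ) : hPoly m J J' ≠ 0 :=
  mul_ne_zero (Finset.prod_ne_zero_iff.2 fun _ _ => X_add_C_ne_zero _)
    (Finset.prod_ne_zero_iff.2 fun _ _ => X_add_C_ne_zero _)

/-- The polynomial `h_γ`. -/
abbrev hGam (γ : Gam) : k[X] := hPoly m γ.1.set γ.2.set

theorem hGam_mul (γ δ : Gam) :
    hGam m γ * hGam m δ = hPoly m (γ.1.set ∩ δ.1.set) (γ.2.set ∩ δ.2.set) ^ 2 *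
      hGam m (γ + δ) := by
  have h1 := prod_mul_prod_eq_symmDiff (fun j : ℤ => (X + C (j : k))) γ.1.set δ.1.set
  have h2 := prod_mul_prod_eq_symmDiff (fun j : ℤ => (X + C ((j : k) + m))) γ.2.set δ.2.set
  rw [Finset.prod_pow] at h1 h2
  simp only [hGam, hPoly, Prod.fst_add, Prod.snd_add, ZFin.set_add]
  rw [mul_mul_mul_comm, h1, h2]
  ring

open Classical in
/-- The indices of the involutions belonging to a pair of sets. -/
def pairs (J J' : Finset ℤ) : Finset (k × ℤ) :=
  J.image (fun j => ((0 : k), j)) ∪ J'.image (fun j => (m, j))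

theorem admissible_pairs (J J' : Finset ℤ) : Admissible m (pairs m J J') := by
  intro s hs
  simp only [pairs, Finset.mem_union, Finset.mem_image] at hs
  grind

variable {m}

theorem prod_pairs (h0 : m ≠ 0) {R : Type*} [CommMonoid R] (F : k × ℤ → R) (J J' : Finset ℤ) :
    ∏ s ∈ pairs m J J', F s = (∏ j ∈ J, F (0, j)) * ∏ j ∈ J', F (m, j) := by
  classical
  rw [pairs, Finset.prod_union, Finset.prod_image, Finset.prod_image]
  · intro a _ b _ h; simpa using h
  · intro a _ b _ h; simpa using h
  · rw [Finset.disjoint_left]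
    intro s hs hs'
    simp only [Finset.mem_image] at hs hs'
    grind

theorem mem_indexList {γ : Gam} {s : k × ℤ} :
    s ∈ indexList m γ ↔ (s.1 = 0 ∧ s.2 ∈ γ.1.set) ∨ (s.1 = m ∧ s.2 ∈ γ.2.set) := by
  obtain ⟨μ, n⟩ := s
  simp only [indexList, List.mem_append, List.mem_map, Finset.mem_sort, Prod.mk.injEq]
  grind

theorem indexList_nodup (h0 : m ≠ 0) (γ : Gam) : (indexList m γ).Nodup := by
  refine List.Nodup.append ?_ ?_ ?_
  · exact (Finset.sort_nodup _ _).map fun a b h => by simpa using h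
  · exact (Finset.sort_nodup _ _).map fun a b h => by simpa using h
  · intro s hs hs'
    simp only [List.mem_map] at hs hs'
    grind

open Classical in
theorem count_indexList_zero (h0 : m ≠ 0) (γ : Gam) (j : ℤ) :
    (indexList m γ).count (0, j) = if j ∈ γ.1.set then 1 else 0 := by
  rw [(indexList_nodup h0 γ).count]
  simp [mem_indexList, h0.symm]

open Classical in
theorem count_indexList (h0 : m ≠ 0) (γ : Gam) (j : ℤ) :
    (indexList m γ).count (m, j) = if j ∈ γ.2.set then 1 else 0 := by
  rw [(indexList_nodup h0 γ).count]
  simp [mem_indexList, h0]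

/-- An involution applied twice has exponent `1` in every degree, which is pulled out as the product
over `I ∩ J`. The remaining indices are applied once or not at all. -/
theorem prod_expo_add (L : ℤ → k[X]) {A I J : Finset ℤ} (hA : I ∩ J ⊆ A) (i : ℤ) :
    ∏ j ∈ A, L j ^ expo ((if j ∈ J then 1 else 0) + if j ∈ I then 1 else 0) j i =
      (∏ j ∈ I ∩ J, L j) * ∏ j ∈ A, L j ^ expo (if j ∈ symmDiff J I then 1 else 0) j i := by
  conv_rhs => rw [← Finset.inter_eq_right.2 hA]
  rw [← Finset.prod_ite_mem, ← Finset.prod_mul_distrib]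
  refine Finset.prod_congr rfl fun j _ => ?_
  have e2 : expo 2 j i = 1 := by
    have : ¬ Odd 2 := by decide
    simp [expo, this]
  have e0 : expo 0 j i = 0 := by simp [expo]
  by_cases h1 : j ∈ I <;> by_cases h2 : j ∈ J <;> simp [h1, h2, Finset.mem_symmDiff, e0, e2]

open Classical in
theorem divFun_theta (h0 : m ≠ 0) (γ δ : Gam) (i : ℤ) {J J' : Finset ℤ}
    (hJ : γ.1.set ∩ δ.1.set ⊆ J) (hJ' : γ.2.set ∩ δ.2.set ⊆ J') :
    divFun (pairs m J J') (fun s => (indexList m δ).count s + (indexList m γ).count s) i =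
      hPoly m (γ.1.set ∩ δ.1.set) (γ.2.set ∩ δ.2.set) *
        divFun (pairs m J J') (fun s => (indexList m (δ + γ)).count s) i := by
  rw [divFun, divFun, prod_pairs h0, prod_pairs h0]
  have hc : ∀ j, (indexList m (δ + γ)).count (0, j) =
      if j ∈ symmDiff δ.1.set γ.1.set then 1 else 0 := count_indexList_zero h0 (δ + γ)
  have hd : ∀ j, (indexList m (δ + γ)).count (m, j) =
      if j ∈ symmDiff δ.2.set γ.2.set then 1 else 0 := count_indexList h0 (δ + γ)
  simp only [hc, hd]
  simp only [count_indexList_zero h0, count_indexList h0]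
  have h1 := prod_expo_add (fun j => lin (0 : k) j) hJ i
  have h2 := prod_expo_add (fun j => lin m j) hJ' i
  rw [h1, h2, hPoly]
  have h3 : ∀ j : ℤ, lin (0 : k) j = X + C (j : k) := fun j => by simp [lin]
  simp only [h3]
  simp only [lin]
  ring

-- The first application of any involution multiplies the side containing degree `0`, whatever the
-- sign of the index. This is where `h_γ` comes from.
open Classical in
theorem divFun_indexList_zero (h0 : m ≠ 0) (γ : Gam) :
    divFun (pairs m γ.1.set γ.2.set) (fun s => (indexList m γ).count s) 0 = hGam m γ := by
  have e1 : ∀ j : ℤ, expo 1 j 0 = 1 := fun j => by simp [expo]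
  rw [divFun, prod_pairs h0, hGam, hPoly]
  refine congrArg₂ (· * ·) (Finset.prod_congr rfl fun j hj => ?_)
    (Finset.prod_congr rfl fun j hj => ?_)
  · rw [count_indexList_zero h0, if_pos hj, e1, pow_one, lin, add_zero]
  · rw [count_indexList h0, if_pos hj, e1, pow_one, lin]

end

/-! ### Existence and uniqueness of `Θ`. -/

section Theta

variable {k : Type u} [Field k] [CharZero k] {m : k} (hm : ∀ n : ℤ, m ≠ (n : k))
include hm

omit [CharZero k] in
theorem m_ne_zero : m ≠ 0 := by simpa using hm 0

open Classical in
theorem hasDiv_incl (γ : Gam) {T : Finset (k × ℤ)} (hT : Admissible m T)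
    (hγ : ∀ s ∈ indexList m γ, s ∈ T) :
    HasDiv (incl m γ (AMod m)) (divFun T fun s => (indexList m γ).count s) := by
  have h : HasDiv (𝟙 (AMod m)) (divFun T 0) := by
    rw [divFun_zero]
    exact hasDiv_id
  have := hasDiv_iotaList hm hT h (indexList m γ) hγ
  have h0 : (fun s => (0 : k × ℤ → ℕ) s + (indexList m γ).count s) =
      fun s => (indexList m γ).count s := by simp
  rw [Category.comp_id, h0] at this
  exact this

omit hm [CharZero k] in
theorem mem_pairs_of_mem_indexList {γ : Gam} {J J' : Finset ℤ} (hJ : γ.1.set ⊆ J)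
    (hJ' : γ.2.set ⊆ J') : ∀ s ∈ indexList m γ, s ∈ pairs m J J' := by
  intro s hs
  rw [mem_indexList] at hs
  obtain ⟨μ, n⟩ := s
  simp only [pairs, Finset.mem_union, Finset.mem_image, Prod.mk.injEq]
  rcases hs with ⟨h, h'⟩ | ⟨h, h'⟩
  · exact Or.inl ⟨n, hJ h', h.symm, rfl⟩
  · exact Or.inr ⟨n, hJ' h', h.symm, rfl⟩

theorem exists_theta (γ δ : Gam) : ∃ Θ, IsTheta m γ δ Θ ∧ IsIso Θ := by
  classical
  -- A common index set for `γ`, `δ` and `δ + γ`, so that the families can be compared factor by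
  -- factor.
  let T := pairs m (γ.1.set ∪ δ.1.set) (γ.2.set ∪ δ.2.set)
  have hT : Admissible m T := admissible_pairs _ _ _
  have hγ : ∀ s ∈ indexList m γ, s ∈ T :=
    mem_pairs_of_mem_indexList Finset.subset_union_left Finset.subset_union_left
  have hδ : ∀ s ∈ indexList m δ, s ∈ T :=
    mem_pairs_of_mem_indexList Finset.subset_union_right Finset.subset_union_right
  have hs : ∀ I J : Finset ℤ, symmDiff J I ⊆ I ∪ J := fun I J j hj => by
    rw [Finset.mem_symmDiff] at hj
    rw [Finset.mem_union]
    tauto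
  have hγδ : ∀ s ∈ indexList m (δ + γ), s ∈ T :=
    mem_pairs_of_mem_indexList (hs _ _) (hs _ _)
  have H₁ := hasDiv_iotaList hm hT (hasDiv_incl hm δ hT hδ) (indexList m γ) hγ
  have H₂ := hasDiv_incl hm (δ + γ) hT hγδ
  have e : divFun T (fun s => (indexList m δ).count s + (indexList m γ).count s) =
      fun i => hPoly m (γ.1.set ∩ δ.1.set) (γ.2.set ∩ δ.2.set) *
        divFun T (fun s => (indexList m (δ + γ)).count s) i := funext fun i =>
    divFun_theta (m_ne_zero hm) γ δ i
      (Finset.inter_subset_left.trans Finset.subset_union_left)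
      (Finset.inter_subset_left.trans Finset.subset_union_left)
  rw [e] at H₁
  obtain ⟨Θ, hΘ, h⟩ := HasDiv.exists_iso (hPoly_ne_zero _ _ _) H₁ H₂
  exact ⟨Θ, h, hΘ⟩

theorem hasDiv_incl_self (γ : Gam) : ∃ a, HasDiv (incl m γ (AMod m)) a ∧ a 0 = hGam m γ := by
  classical
  exact ⟨_, hasDiv_incl hm γ (admissible_pairs _ _ _)
    (mem_pairs_of_mem_indexList subset_rfl subset_rfl), divFun_indexList_zero (m_ne_zero hm) γ⟩

/-- Left multiplication by `h` and the inclusion into `A` are injective. Hence the choice in `theta`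
is no choice. -/
theorem IsTheta.unique {γ δ : Gam}
    {Θ Θ' : (iota m γ).obj ((iota m δ).obj (AMod m)) ⟶ (iota m (δ + γ)).obj (AMod m)}
    (h : IsTheta m γ δ Θ) (h' : IsTheta m γ δ Θ') : Θ = Θ' := by
  obtain ⟨a, H, -⟩ := hasDiv_incl_self hm (δ + γ)
  exact GrMod.hom_ext fun v => H.injective
    (zp_mul_left_injective (hPoly_ne_zero m _ _) ((h v).trans (h' v).symm))

theorem theta_spec (γ δ : Gam) : IsTheta m γ δ (theta m γ δ) ∧ IsIso (theta m γ δ) := by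
  obtain ⟨Θ, h, hΘ⟩ := exists_theta hm γ δ
  have hex : ∃ Θ, IsTheta m γ δ Θ := ⟨Θ, h⟩
  have h1 : IsTheta m γ δ (theta m γ δ) := by
    rw [theta, dif_pos hex]
    exact hex.choose_spec
  rw [IsTheta.unique hm h1 h]
  exact ⟨h, hΘ⟩

end Theta

/-! ### `D_γ` as a copy of `k[z]`, and the product in these coordinates. -/

section DComp

variable {k : Type u} [Field k] {m : k}

/-- The polynomial `p` such that `φ ∈ D_γ` is left multiplication by `p(z)`. -/
def dVal (γ : Gam) : DComp m γ →ₗ[k] k[X] where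
  toFun φ := cf 0 (emb (incl m γ (AMod m)) (GrMod.app φ (1 : GWA k (fm m))))
  map_add' φ ψ := by
    rw [← map_add, ← map_add]; rfl
  map_smul' r φ := by
    rw [RingHom.id_apply, ← map_smul, ← map_smul]; rfl

/-- A homomorphism from `A` is determined by the image of `1`, which has degree `0` and is therefore
a polynomial in `z`. -/
theorem emb_app (γ : Gam) (φ : DComp m γ) (a : GWA k (fm m)) :
    emb (incl m γ (AMod m)) (GrMod.app φ a) = zp (fm m) (dVal γ φ) * a := by
  have h1 : GrMod.app φ a = op a • GrMod.app φ (1 : GWA k (fm m)) :=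
    (congrArg (fun b : GWA k (fm m) => GrMod.app φ b) (one_mul a)).symm.trans
      ((GrMod.app φ).map_smul (op a) (1 : GWA k (fm m)))
  have h2 : GrMod.app φ (1 : GWA k (fm m)) ∈ ((iota m γ).obj (AMod m)).comp 0 :=
    GrMod.app_mem φ GWA.one_mem_comp
  have h3 := (cf_eq_of_mem (emb_mem (incl m γ (AMod m)) h2)).2
  rw [base_zero, mul_one] at h3
  rw [h1, emb_smul, h3]
  rfl

theorem isLeftMul_dVal (γ : Gam) (φ : DComp m γ) : IsLeftMul m φ (zp (fm m) (dVal γ φ)) :=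
  emb_app γ φ

theorem inclList_naturality (f : k[X]) (l : List (k × ℤ)) {M N : GrMod k f} (g : M ⟶ N)
    (v : ((GrMod.iotaList f l).obj M).carrier) :
    GrMod.app (GrMod.inclList f l N) (GrMod.app ((GrMod.iotaList f l).map g) v) =
      GrMod.app g (GrMod.app (GrMod.inclList f l M) v) := by
  induction l with
  | nil => rfl
  | cons s l ih => exact ih v.1

variable [CharZero k] (hm : ∀ n : ℤ, m ≠ (n : k))
include hm

theorem dvd_dVal (γ : Gam) (φ : DComp m γ) : hGam m γ ∣ dVal γ φ := by
  obtain ⟨a, H, ha⟩ := hasDiv_incl_self hm γ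
  rw [← ha]
  exact H.dvd_co 0 _

theorem dVal_injective (γ : Gam) : Function.Injective (dVal (m := m) γ) := by
  obtain ⟨a, H, -⟩ := hasDiv_incl_self hm γ
  intro φ ψ h
  exact GrMod.hom_ext fun v => H.injective (by
    have h1 := emb_app γ φ v
    have h2 := emb_app γ ψ v
    rw [h] at h1
    exact h1.trans h2.symm)

theorem exists_dVal (γ : Gam) (p : k[X]) : ∃ φ : DComp m γ, dVal γ φ = hGam m γ * p := by
  obtain ⟨a, H, ha⟩ := hasDiv_incl_self hm γ
  obtain ⟨w, hw, hwp⟩ := H.exists_of_dvd 0 (p := hGam m γ * p) (by rw [ha]; exact dvd_mul_right _ _)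
  refine ⟨⟨orbit w, fun i v hv => ?_⟩, ?_⟩
  · have := ((iota m γ).obj (AMod m)).smul_mem 0 i v w hw hv
    rwa [zero_add] at this
  · rw [← hwp]
    change cf 0 (emb (incl m γ (AMod m)) (op (1 : GWA k (fm m)) • w)) = _
    rw [MulOpposite.op_one, one_smul]
    rfl

/-- Since `ι_δ(a)` is a restriction of `a`, composing with `b` multiplies the two polynomials inside
`A`, and `Θ` divides the result by `h_{γ∩δ}`. -/
theorem dVal_mul {γ δ : Gam} (a : DComp m γ) (b : DComp m δ) :
    hPoly m (γ.1.set ∩ δ.1.set) (γ.2.set ∩ δ.2.set) * dVal (γ + δ) (dMul m a b) =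
      dVal γ a * dVal δ b := by
  have h1 := (theta_spec hm δ γ).1
    (GrMod.app ((iota m δ).map a) (GrMod.app b (1 : GWA k (fm m))))
  have h2 : GrMod.app (incl m δ ((iota m γ).obj (AMod m)))
      (GrMod.app ((iota m δ).map a) (GrMod.app b (1 : GWA k (fm m)))) =
      GrMod.app a (emb (incl m δ (AMod m)) (GrMod.app b (1 : GWA k (fm m)))) :=
    inclList_naturality _ _ _ _
  have h3 := emb_app γ a (emb (incl m δ (AMod m)) (GrMod.app b (1 : GWA k (fm m))))
  have h4 := emb_app δ b (1 : GWA k (fm m))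
  rw [h2] at h1
  have h5 := h1.trans h3
  rw [h4, mul_one, ← zp_mul] at h5
  have h6 := congrArg (cf 0) h5
  rw [cf_zp, hElem_eq, cf_zp_mul, Finset.inter_comm, Finset.inter_comm δ.2.set] at h6
  exact h6

/-- The isomorphism `D_γ ≅ k[z]` that sends left multiplication by `h_γ p(z)` to `p`. -/
def dPoly (γ : Gam) : DComp m γ ≃ₗ[k] k[X] :=
  LinearEquiv.ofBijective
    { toFun := fun φ => (dvd_dVal hm γ φ).choose
      map_add' := fun φ ψ => mul_left_cancel₀ (hPoly_ne_zero m γ.1.set γ.2.set) (by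
        rw [mul_add, ← (dvd_dVal hm γ _).choose_spec, ← (dvd_dVal hm γ _).choose_spec,
          ← (dvd_dVal hm γ _).choose_spec, map_add])
      map_smul' := fun r φ => mul_left_cancel₀ (hPoly_ne_zero m γ.1.set γ.2.set) (by
        rw [RingHom.id_apply, mul_smul_comm, ← (dvd_dVal hm γ _).choose_spec,
          ← (dvd_dVal hm γ _).choose_spec, map_smul]) }
    ⟨fun φ ψ h => dVal_injective hm γ (by
      rw [(dvd_dVal hm γ φ).choose_spec, (dvd_dVal hm γ ψ).choose_spec]
      exact congrArg _ h),
    fun p => by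
      obtain ⟨φ, hφ⟩ := exists_dVal hm γ p
      exact ⟨φ, mul_left_cancel₀ (hPoly_ne_zero m γ.1.set γ.2.set)
        ((dvd_dVal hm γ φ).choose_spec.symm.trans hφ)⟩⟩

theorem dVal_eq (γ : Gam) (φ : DComp m γ) : dVal γ φ = hGam m γ * dPoly hm γ φ :=
  (dvd_dVal hm γ φ).choose_spec

/-- Combine `dVal_mul` with `h_γ h_δ = h_{γ∩δ}² h_{γ+δ}` and cancel `h_{γ∩δ} h_{γ+δ}`: one of the
two factors `h_{γ∩δ}` survives. -/
theorem dPoly_mul {γ δ : Gam} (a : DComp m γ) (b : DComp m δ) :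
    dPoly hm (γ + δ) (dMul m a b) =
      hPoly m (γ.1.set ∩ δ.1.set) (γ.2.set ∩ δ.2.set) * (dPoly hm γ a * dPoly hm δ b) := by
  have h := dVal_mul hm a b
  rw [dVal_eq hm, dVal_eq hm, dVal_eq hm] at h
  refine mul_left_cancel₀ (mul_ne_zero (hPoly_ne_zero m (γ.1.set ∩ δ.1.set) (γ.2.set ∩ δ.2.set))
    (hPoly_ne_zero m (γ + δ).1.set (γ + δ).2.set)) ?_
  linear_combination h + dPoly hm γ a * dPoly hm δ b * hGam_mul m γ δ

theorem isLeftMul_of_dPoly {γ : Gam} {φ : DComp m γ} (h : dPoly hm γ φ = 1) :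
    IsLeftMul m φ (hElem m γ.1.set γ.2.set) := by
  have := isLeftMul_dVal γ φ
  rwa [dVal_eq hm, h, mul_one] at this

end DComp

/-! ### The presented ring is spanned by the pieces `k[z] c_γ`. -/

section Presentation

variable {k : Type u} [Field k] (m : k)

/-- The element `z = c₀²` of the presented ring. -/
def zed : Pres m := presC m 0 ^ 2

theorem presC_sq (n : ℤ) : presC m n ^ 2 = aeval (zed m) (X + C (n : k)) := by
  have h : (Ideal.Quotient.mk (presIdeal m)) ((polyC k n ^ 2 - (n : MvPolynomial (ℤ ⊕ ℤ) k)) -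
      (polyC k 0 ^ 2 - ((0 : ℤ) : MvPolynomial (ℤ ⊕ ℤ) k))) = 0 :=
    Ideal.Quotient.eq_zero_iff_mem.2 (Ideal.subset_span (Or.inl ⟨n, 0, rfl⟩))
  simp only [map_sub, map_pow, map_intCast, Int.cast_zero, sub_zero] at h
  simp only [map_add, aeval_X, map_intCast]
  rw [zed, presC, presC]
  linear_combination h

theorem presD_sq (n : ℤ) : presD m n ^ 2 = aeval (zed m) (X + C ((n : k) + m)) := by
  have h : (Ideal.Quotient.mk (presIdeal m)) (polyC k n ^ 2 -
      (polyD k n ^ 2 - MvPolynomial.C m)) = 0 :=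
    Ideal.Quotient.eq_zero_iff_mem.2 (Ideal.subset_span (Or.inr ⟨n, rfl⟩))
  have h1 := presC_sq m n
  have h2 : (Ideal.Quotient.mk (presIdeal m)) (MvPolynomial.C m) = algebraMap k (Pres m) m := rfl
  simp only [map_sub, map_pow, h2] at h
  simp only [map_add, aeval_X, aeval_C, map_intCast] at h1 ⊢
  rw [presD]
  rw [presC] at h1
  linear_combination h1 - h

/-- The monomial `c_γ = ∏ c_j ∏ d_j'`. -/
def cMon (γ : Gam) : Pres m := (∏ j ∈ γ.1.set, presC m j) * ∏ j ∈ γ.2.set, presD m j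

/-- The squares `c_j² = z + j` and `d_j² = z + j + m` of the repeated variables multiply to
`h_{γ∩δ}`. These are the structure constants of `dPoly_mul`. -/
theorem cMon_mul (γ δ : Gam) : cMon m γ * cMon m δ =
    aeval (zed m) (hPoly m (γ.1.set ∩ δ.1.set) (γ.2.set ∩ δ.2.set)) * cMon m (γ + δ) := by
  have h1 := prod_mul_prod_eq_symmDiff (presC m) γ.1.set δ.1.set
  have h2 := prod_mul_prod_eq_symmDiff (presD m) γ.2.set δ.2.set
  simp only [presC_sq, presD_sq] at h1 h2
  simp only [cMon, hPoly, map_mul, map_prod, Prod.fst_add, Prod.snd_add, ZFin.set_add]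
  rw [mul_mul_mul_comm, h1, h2]
  ring

theorem cMon_zero : cMon m 0 = 1 := by
  simp [cMon, ZFin.set_zero]

theorem cMon_degC (n : ℤ) : cMon m (degC n) = presC m n := by
  simp [cMon, degC, ZFin.set_zero, ZFin.set_ofSet]

theorem cMon_degD (n : ℤ) : cMon m (degD n) = presD m n := by
  simp [cMon, degD, ZFin.set_zero, ZFin.set_ofSet]

theorem degC_add_self (n : ℤ) : degC n + degC n = 0 := by
  refine Prod.ext ?_ (add_zero _)
  exact symmDiff_self ({n} : Finset ℤ)

theorem degD_add_self (n : ℤ) : degD n + degD n = 0 := by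
  refine Prod.ext (add_zero _) ?_
  exact symmDiff_self ({n} : Finset ℤ)

theorem ofSet_insert {J : Finset ℤ} {n : ℤ} (h : n ∉ J) :
    ZFin.ofSet (insert n J) = ZFin.ofSet {n} + ZFin.ofSet J := by
  change insert n J = symmDiff {n} J
  rw [(Finset.disjoint_singleton_left.2 h).symmDiff_eq_sup]
  rfl

theorem sum_degC (J : Finset ℤ) : ∑ j ∈ J, degC j = (ZFin.ofSet J, 0) := by
  induction J using Finset.induction_on with
  | empty => rfl
  | insert n J h ih =>
    rw [Finset.sum_insert h, ih, ofSet_insert h]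
    exact Prod.ext rfl (add_zero _)

theorem sum_degD (J : Finset ℤ) : ∑ j ∈ J, degD j = (0, ZFin.ofSet J) := by
  induction J using Finset.induction_on with
  | empty => rfl
  | insert n J h ih =>
    rw [Finset.sum_insert h, ih, ofSet_insert h]
    exact Prod.ext (add_zero _) rfl

/-- The part `k[z] c_γ` of the presented ring. -/
def zPart (γ : Gam) : Submodule k (Pres m) where
  carrier := {p | ∃ q : k[X], p = aeval (zed m) q * cMon m γ}
  add_mem' := by
    rintro _ _ ⟨q, rfl⟩ ⟨q', rfl⟩
    exact ⟨q + q', by rw [map_add, add_mul]⟩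
  zero_mem' := ⟨0, by simp⟩
  smul_mem' := by
    rintro r _ ⟨q, rfl⟩
    exact ⟨r • q, by rw [map_smul, smul_mul_assoc]⟩

variable {m}

theorem mul_mem_zPart {γ δ : Gam} {p q : Pres m} (hp : p ∈ zPart m γ) (hq : q ∈ zPart m δ) :
    p * q ∈ zPart m (γ + δ) := by
  obtain ⟨p, rfl⟩ := hp
  obtain ⟨q, rfl⟩ := hq
  refine ⟨p * q * hPoly m (γ.1.set ∩ δ.1.set) (γ.2.set ∩ δ.2.set), ?_⟩
  rw [mul_mul_mul_comm, cMon_mul, map_mul, map_mul, mul_assoc _ _ (cMon m _)]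

theorem one_mem_zPart : (1 : Pres m) ∈ zPart m 0 := ⟨1, by rw [cMon_zero, map_one, one_mul]⟩

theorem pow_mem_zPart {γ : Gam} {p : Pres m} (hp : p ∈ zPart m γ) (n : ℕ) :
    p ^ n ∈ zPart m (n • γ) := by
  induction n with
  | zero => simpa using one_mem_zPart
  | succ n ih => rw [pow_succ, succ_nsmul]; exact mul_mem_zPart ih hp

theorem mk_X_mem_zPart (s : ℤ ⊕ ℤ) : (Ideal.Quotient.mk (presIdeal m) (MvPolynomial.X s)) ∈
    zPart m (Sum.elim degC degD s) := by
  rcases s with n | n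
  · exact ⟨1, by rw [map_one, one_mul]; exact (cMon_degC m n).symm⟩
  · exact ⟨1, by rw [map_one, one_mul]; exact (cMon_degD m n).symm⟩

theorem mk_monomial_mem_zPart (d : (ℤ ⊕ ℤ) →₀ ℕ) :
    (Ideal.Quotient.mk (presIdeal m) (MvPolynomial.monomial d 1)) ∈
      zPart m (Finsupp.weight (Sum.elim degC degD) d) := by
  induction d using Finsupp.induction_linear with
  | zero => rw [map_zero]; exact one_mem_zPart
  | add d d' h h' =>
    have : (MvPolynomial.monomial (d + d') (1 : k)) =
        MvPolynomial.monomial d 1 * MvPolynomial.monomial d' 1 := by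
      rw [MvPolynomial.monomial_mul, one_mul]
    rw [map_add, this, map_mul]
    exact mul_mem_zPart h h'
  | single s n =>
    rw [← MvPolynomial.X_pow_eq_monomial, map_pow, Finsupp.weight_single]
    exact pow_mem_zPart (mk_X_mem_zPart s) n

/-- The variables lie in their pieces `k[z] c_γ` and these pieces multiply according to the degrees,
so every monomial lies in the piece of its weight. -/
theorem presComp_le_zPart (γ : Gam) : presComp m γ ≤ zPart m γ := by
  rintro _ ⟨P, hP, rfl⟩
  change Ideal.Quotient.mk (presIdeal m) P ∈ _
  rw [P.as_sum, map_sum]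
  refine Submodule.sum_mem _ fun d hd => ?_
  have h1 : Finsupp.weight (Sum.elim degC degD) d = γ := hP (MvPolynomial.mem_support_iff.1 hd)
  have h2 : MvPolynomial.monomial d (P.coeff d) = P.coeff d • MvPolynomial.monomial d (1 : k) := by
    rw [MvPolynomial.smul_monomial, smul_eq_mul, mul_one]
  rw [h2, ← h1]
  exact (zPart m _).smul_mem (P.coeff d) (mk_monomial_mem_zPart d)

theorem zPart_le_presComp (γ : Gam) : zPart m γ ≤ presComp m γ := by
  rintro _ ⟨q, rfl⟩
  have h1 : ∀ q : k[X], MvPolynomial.IsWeightedHomogeneous (Sum.elim degC degD)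
      (aeval (polyC k 0 ^ 2) q) 0 := by
    -- Every element of `Γ` has order dividing two, so `z = c₀²` has degree `0`.
    have h0 : MvPolynomial.IsWeightedHomogeneous (Sum.elim degC degD) (polyC k 0 ^ 2) 0 := by
      have := (MvPolynomial.isWeightedHomogeneous_X k (Sum.elim degC degD) (Sum.inl 0)).pow 2
      rwa [two_nsmul, Sum.elim_inl, degC_add_self] at this
    intro q
    induction q using Polynomial.induction_on' with
    | add p q hp hq => rw [map_add]; exact hp.add hq
    | monomial n r =>
      rw [aeval_monomial]
      have := (MvPolynomial.isWeightedHomogeneous_C (Sum.elim degC degD) r).mul (h0.pow n)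
      rwa [smul_zero, add_zero] at this
  have h2 := (h1 q).mul ((MvPolynomial.IsWeightedHomogeneous.prod γ.1.set (polyC k) degC
    fun j _ => MvPolynomial.isWeightedHomogeneous_X k (Sum.elim degC degD) (Sum.inl j)).mul
    (MvPolynomial.IsWeightedHomogeneous.prod γ.2.set (polyD k) degD
      fun j _ => MvPolynomial.isWeightedHomogeneous_X k (Sum.elim degC degD) (Sum.inr j)))
  rw [sum_degC, sum_degD, zero_add] at h2
  have h3 : ((ZFin.ofSet γ.1.set, 0) + (0, ZFin.ofSet γ.2.set) : Gam) = γ :=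
    Prod.ext (add_zero _) (zero_add _)
  rw [h3] at h2
  refine ⟨_, h2, ?_⟩
  change Ideal.Quotient.mkₐ k (presIdeal m) _ = _
  rw [map_mul, map_mul, map_prod, map_prod, ← Polynomial.aeval_algHom_apply, map_pow]
  rfl

/-- A homomorphism from the presented ring to the group algebra of `Γ` over a field that contains
square roots of all `z + n` and `z + n + m`. -/
theorem exists_hom_groupAlgebra (m : k) : ∃ (K : Type u) (_ : Field K) (j : k[X] →+* K)
    (_ : Function.Injective j) (χ : Pres m →+* AddMonoidAlgebra K Gam) (u : Gam → K),
    (∀ γ, u γ ≠ 0) ∧ ∀ q γ, χ (aeval (zed m) q * cMon m γ) =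
      AddMonoidAlgebra.single γ (j q * u γ) := by
  let K := AlgebraicClosure (RatFunc k)
  let j : k[X] →+* K := (algebraMap (RatFunc k) K).comp (algebraMap k[X] (RatFunc k))
  have hj : Function.Injective j :=
    (algebraMap (RatFunc k) K).injective.comp (RatFunc.algebraMap_injective k)
  have hsq : ∀ c : k, ∃ r : K, r ^ 2 = j (X + C c) := fun c =>
    IsAlgClosed.exists_pow_nat_eq _ two_pos
  choose r hr using hsq
  have hr0 : ∀ c, r c ≠ 0 := fun c h => by
    have := hr c
    rw [h, zero_pow two_ne_zero] at this
    exact X_add_C_ne_zero c ((map_eq_zero_iff j hj).1 this.symm)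
  let i0 : K →+* AddMonoidAlgebra K Gam := AddMonoidAlgebra.singleZeroRingHom
  have hi0 : ∀ a, i0 a = AddMonoidAlgebra.single 0 a := fun a => rfl
  let χ' : MvPolynomial (ℤ ⊕ ℤ) k →+* AddMonoidAlgebra K Gam :=
    -- Each variable goes to a square root of the linear polynomial that is its square, placed in
    -- the degree of the variable; its square falls into degree `0`, so the relations hold.
    MvPolynomial.eval₂Hom (i0.comp (j.comp C)) (Sum.elim
      (fun n => AddMonoidAlgebra.single (degC n) (r n))
      (fun n => AddMonoidAlgebra.single (degD n) (r (n + m))))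
  have hχC : ∀ n, χ' (polyC k n) = AddMonoidAlgebra.single (degC n) (r n) := fun n =>
    MvPolynomial.eval₂Hom_X' _ _ _
  have hχD : ∀ n, χ' (polyD k n) = AddMonoidAlgebra.single (degD n) (r (n + m)) := fun n =>
    MvPolynomial.eval₂Hom_X' _ _ _
  have hχc : ∀ a, χ' (MvPolynomial.C a) = i0 (j (C a)) := fun a => MvPolynomial.eval₂Hom_C _ _ _
  have hC2 : ∀ n : ℤ, χ' (polyC k n) ^ 2 = i0 (j (X + C (n : k))) := fun n => by
    rw [hχC, pow_two, AddMonoidAlgebra.single_mul_single, degC_add_self, ← pow_two, hr, hi0]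
  have hD2 : ∀ n : ℤ, χ' (polyD k n) ^ 2 = i0 (j (X + C ((n : k) + m))) := fun n => by
    rw [hχD, pow_two, AddMonoidAlgebra.single_mul_single, degD_add_self, ← pow_two, hr, hi0]
  have hker : ∀ p ∈ presIdeal m, χ' p = 0 := by
    intro p hp
    change p ∈ RingHom.ker χ'
    refine Ideal.span_le.2 ?_ hp
    rintro _ (⟨n, l, rfl⟩ | ⟨n, rfl⟩)
    · change χ' _ = 0
      simp only [map_sub, map_pow, hC2, map_add, map_intCast]
      ring
    · change χ' _ = 0
      simp only [map_sub, map_pow, hC2, hD2, hχc, map_add, map_intCast]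
      ring
  let χ : Pres m →+* AddMonoidAlgebra K Gam := Ideal.Quotient.lift (presIdeal m) χ' hker
  have hC : ∀ n, χ (presC m n) = AddMonoidAlgebra.single (degC n) (r n) := hχC
  have hD : ∀ n, χ (presD m n) = AddMonoidAlgebra.single (degD n) (r (n + m)) := hχD
  have hq : ∀ q : k[X], χ (aeval (zed m) q) = i0 (j q) := by
    have : χ.comp (aeval (zed m) : k[X] →ₐ[k] Pres m).toRingHom = i0.comp j := by
      refine Polynomial.ringHom_ext (fun a => ?_) ?_
      · change χ (aeval (zed m) (C a)) = i0 (j (C a))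
        rw [aeval_C]
        exact hχc a
      · change χ (aeval (zed m) X) = i0 (j X)
        rw [aeval_X, zed, map_pow]
        have := hC2 0
        rw [Int.cast_zero, C_0, add_zero] at this
        exact this
    exact fun q => RingHom.congr_fun this q
  have hprod : ∀ (J : Finset ℤ) (g : ℤ → Gam) (s : ℤ → K),
      ∏ n ∈ J, AddMonoidAlgebra.single (g n) (s n) =
        AddMonoidAlgebra.single (∑ n ∈ J, g n) (∏ n ∈ J, s n) := by
    intro J g s
    induction J using Finset.induction_on with
    | empty => simp [AddMonoidAlgebra.one_def]
    | insert n J h ih =>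
      rw [Finset.prod_insert h, Finset.prod_insert h, Finset.sum_insert h, ih,
        AddMonoidAlgebra.single_mul_single]
  refine ⟨K, inferInstance, j, hj, χ,
    fun γ => (∏ n ∈ γ.1.set, r n) * ∏ n ∈ γ.2.set, r (n + m), fun γ => ?_, fun q γ => ?_⟩
  · exact mul_ne_zero (Finset.prod_ne_zero_iff.2 fun _ _ => hr0 _)
      (Finset.prod_ne_zero_iff.2 fun _ _ => hr0 _)
  · rw [map_mul, hq, cMon, map_mul, map_prod, map_prod]
    simp only [hC, hD]
    rw [hprod, hprod, AddMonoidAlgebra.single_mul_single, hi0,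
      AddMonoidAlgebra.single_mul_single, zero_add, sum_degC, sum_degD]
    congr 1
    exact Prod.ext (add_zero _) (zero_add _)

end Presentation

/-! ### The isomorphism between `D` and the presented ring. -/

section Iso

variable {k : Type u} [Field k] [CharZero k] {m : k} (hm : ∀ n : ℤ, m ≠ (n : k))

/-- The map from `D` to the presented ring. -/
def toPres : D m →ₗ[k] Pres m :=
  DirectSum.toModule k Gam (Pres m) fun γ =>
    (LinearMap.mulRight k (cMon m γ)) ∘ₗ (aeval (zed m) : k[X] →ₐ[k] Pres m).toLinearMap ∘ₗ
      (dPoly hm γ).toLinearMap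

theorem toPres_of (γ : Gam) (φ : DComp m γ) :
    toPres hm (DirectSum.of (DComp m) γ φ) = aeval (zed m) (dPoly hm γ φ) * cMon m γ :=
  DirectSum.toModule_lof k γ φ

/-- Both sides have structure constants `h_{γ∩δ}`. The product of `D` is only known to be biadditive
here; associativity, commutativity and the unit are transported by the isomorphism. -/
theorem toPres_mul (a b : D m) : toPres hm (a * b) = toPres hm a * toPres hm b := by
  induction a using DirectSum.induction_on with
  | zero => rw [zero_mul, map_zero, zero_mul]
  | add a a' h h' => rw [add_mul, map_add, h, h', map_add, add_mul]
  | of γ φ =>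
    induction b using DirectSum.induction_on with
    | zero => rw [mul_zero, map_zero, mul_zero]
    | add b b' h h' => rw [mul_add, map_add, h, h', map_add, mul_add]
    | of δ ψ =>
      rw [DirectSum.of_mul_of, toPres_of, toPres_of, toPres_of, mul_mul_mul_comm, cMon_mul]
      have : dPoly hm (γ + δ) (GradedMonoid.GMul.mul φ ψ) = _ := dPoly_mul hm φ ψ
      rw [this, map_mul, map_mul]
      ring

theorem mem_zPart_iff (γ : Gam) (p : Pres m) :
    p ∈ zPart m γ ↔ ∃ φ : DComp m γ, toPres hm (DirectSum.of (DComp m) γ φ) = p := by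
  constructor
  · rintro ⟨q, rfl⟩
    exact ⟨(dPoly hm γ).symm q, by rw [toPres_of, LinearEquiv.apply_symm_apply]⟩
  · rintro ⟨φ, rfl⟩
    exact ⟨_, toPres_of hm γ φ⟩

theorem toPres_surjective : Function.Surjective (toPres hm) := by
  intro p
  obtain ⟨P, rfl⟩ := Ideal.Quotient.mk_surjective p
  induction P using MvPolynomial.induction_on with
  | C a =>
    obtain ⟨φ, hφ⟩ := (mem_zPart_iff hm 0 _).1 ((zPart m 0).smul_mem a one_mem_zPart)
    exact ⟨_, hφ.trans (Algebra.algebraMap_eq_smul_one a).symm⟩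
  | add P Q hP hQ =>
    obtain ⟨a, ha⟩ := hP
    obtain ⟨b, hb⟩ := hQ
    exact ⟨a + b, by rw [map_add, map_add, ha, hb]⟩
  | mul_X P s hP =>
    obtain ⟨a, ha⟩ := hP
    obtain ⟨φ, hφ⟩ := (mem_zPart_iff hm _ _).1 (mk_X_mem_zPart (m := m) s)
    exact ⟨a * DirectSum.of (DComp m) _ φ, by rw [toPres_mul, ha, hφ, map_mul]⟩

/-- In the group algebra the `γ`-coefficient of the image of `d` is the polynomial of `d_γ` times a
nonzero constant of the field, so it vanishes only if `d_γ` does. -/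
theorem toPres_injective : Function.Injective (toPres hm) := by
  obtain ⟨K, _, j, hj, χ, u, hu, hχ⟩ := exists_hom_groupAlgebra m
  have key : ∀ (d : D m) (γ : Gam),
      (χ (toPres hm d)).coeff γ = j (dPoly hm γ (d γ)) * u γ := by
    intro d γ
    induction d using DirectSum.induction_on with
    | zero => simp
    | add a b ha hb =>
      rw [map_add, map_add, AddMonoidAlgebra.coeff_add, Finsupp.add_apply, ha, hb,
        DirectSum.add_apply, map_add, map_add, add_mul]
    | of δ φ =>
      rw [toPres_of, hχ]
      by_cases h : δ = γ
      · subst h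
        rw [DirectSum.of_eq_same]
        simp
      · rw [DirectSum.of_eq_of_ne _ _ _ (Ne.symm h)]
        simp [h]
  rw [injective_iff_map_eq_zero]
  intro d hd
  refine DFinsupp.ext fun γ => ?_
  have h1 := key d γ
  rw [hd, map_zero] at h1
  have h2 : j (dPoly hm γ (d γ)) * u γ = 0 := h1.symm
  have h3 := (map_eq_zero_iff j hj).1 ((mul_eq_zero.1 h2).resolve_right (hu γ))
  exact (LinearEquiv.map_eq_zero_iff _).1 h3

/-- The isomorphism between the presented ring and `D`. -/
def presEquiv : Pres m ≃+* D m :=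
  RingEquiv.symm
    { Equiv.ofBijective (toPres hm) ⟨toPres_injective hm, toPres_surjective hm⟩ with
      map_mul' := toPres_mul hm
      map_add' := map_add (toPres hm) }

theorem presEquiv_eq_iff {p : Pres m} {d : D m} : presEquiv hm p = d ↔ toPres hm d = p :=
  (RingEquiv.symm_apply_eq _).trans eq_comm

end Iso

end NCS

end

theorem mainTheorem8 {k : Type u} [Field k] [IsAlgClosed k] [CharZero k] (m : k)
    (hm : ∀ n : ℤ, m ≠ (n : k)) :
    (∀ γ δ : NCS.Gam, NCS.IsTheta m γ δ (NCS.theta m γ δ) ∧ IsIso (NCS.theta m γ δ)) ∧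
    ∃ e : NCS.Pres m ≃+* NCS.D m,
      (∀ (r : k) (p : NCS.Pres m), e (r • p) = r • e p) ∧
      (∃ φ : NCS.DComp m 0, NCS.IsLeftMul m φ 1 ∧ e 1 = DirectSum.of (NCS.DComp m) 0 φ) ∧
      (∀ n : ℤ, ∃ φ : NCS.DComp m (NCS.degC n), NCS.IsLeftMul m φ (NCS.hElem m {n} ∅) ∧
        e (NCS.presC m n) = DirectSum.of (NCS.DComp m) (NCS.degC n) φ) ∧
      (∀ n : ℤ, ∃ φ : NCS.DComp m (NCS.degD n), NCS.IsLeftMul m φ (NCS.hElem m ∅ {n}) ∧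
        e (NCS.presD m n) = DirectSum.of (NCS.DComp m) (NCS.degD n) φ) ∧
      (∀ (γ : NCS.Gam) (p : NCS.Pres m),
        p ∈ NCS.presComp m γ ↔ ∃ φ : NCS.DComp m γ, e p = DirectSum.of (NCS.DComp m) γ φ) := by
  -- The monomial `c_γ` corresponds to the constant polynomial `1` in `D_γ ≅ k[z]`, that is, to left
  -- multiplication by `h_γ`. The degrees `0`, `(n, ∅)` and `(∅, n)` give the images of `1`, `c_n`
  -- and `d_n`.
  have hcMon : ∀ γ : NCS.Gam, ∃ φ : NCS.DComp m γ,
      NCS.IsLeftMul m φ (NCS.hElem m γ.1.set γ.2.set) ∧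
        NCS.presEquiv hm (NCS.cMon m γ) = DirectSum.of (NCS.DComp m) γ φ := fun γ => by
    have h1 := LinearEquiv.apply_symm_apply (NCS.dPoly hm γ) 1
    refine ⟨(NCS.dPoly hm γ).symm 1, NCS.isLeftMul_of_dPoly hm h1,
      (NCS.presEquiv_eq_iff hm).2 ?_⟩
    rw [NCS.toPres_of, h1, map_one, one_mul]
  refine ⟨NCS.theta_spec hm, NCS.presEquiv hm, fun r p => ?_, ?_, fun n => ?_, fun n => ?_,
    fun γ p => ?_⟩
  · rw [NCS.presEquiv_eq_iff, map_smul, (NCS.presEquiv_eq_iff hm).1 rfl]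
  · obtain ⟨φ, h1, h2⟩ := hcMon 0
    have : NCS.hElem m (0 : NCS.Gam).1.set (0 : NCS.Gam).2.set = 1 := by
      simp [NCS.hElem, NCS.ZFin.set_zero]
    rw [this] at h1
    rw [NCS.cMon_zero] at h2
    exact ⟨φ, h1, h2⟩
  · obtain ⟨φ, h1, h2⟩ := hcMon (NCS.degC n)
    rw [NCS.cMon_degC] at h2
    exact ⟨φ, h1, h2⟩
  · obtain ⟨φ, h1, h2⟩ := hcMon (NCS.degD n)
    rw [NCS.cMon_degD] at h2
    exact ⟨φ, h1, h2⟩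
  -- The homogeneous part of degree `γ` is `k[z] c_γ`, which is the image of `D_γ`.
  · rw [le_antisymm (NCS.presComp_le_zPart γ) (NCS.zPart_le_presComp γ),
      NCS.mem_zPart_iff hm]
    simp only [NCS.presEquiv_eq_iff]
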